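/- Let $0<\eta<T$, $2<\alpha\le 3$, $\beta_0=0$, $0<\beta_1\le 1$, $1<\beta_2\le 2$, and $a_i,b_i,\lambda_i\in\mathbb R$ ($i=0,1,2$) with $$a_0+b_0\ne0,\qquad a_1\eta^{1-\beta_1}+b_1T^{1-\beta_1}\neq0,\qquad a_i\eta^{2-\beta_i}+b_iT^{2-\beta_i}\ne0\ \ (i=1,2).$$ For $\nu>0$ let $I^{\nu}u(t)=\frac1{\Gamma(\nu)}\int_0^t(t-s)^{\nu-1}u(s)\,ds$, and let $I^0u=u$. For $\gamma>0$ and $n=\lceil\gamma\rceil$, the Caputo derivative of $u$ on $[0,T]$ is $$\mathfrak D^{\gamma}u(t)=\frac{d^n}{dt^n}\,I^{n-\gamma}\Big(u-\sum_{k=0}^{n-1}\frac{u^{(k)}(0)}{k!}(\cdot)^k\Big)(t)$$ (one-sided derivatives at the endpoints). We say that $\mathfrak D^\gamma u$ exists and is continuous on $[0,T]$ if $u\in C^{n-1}[0,T]$ and the function to which $d^n/dt^n$ is applied is in $C^n[0,T]$. For $u\in C^n[0,T]$ one has $\mathfrak D^\gamma u=I^{n-\gamma}u^{(n)}$. Consider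 the problem $$\mathfrak D^{\alpha}u(t)=f\big(t,u(t),\mathfrak D^{\beta_1}u(t),\mathfrak D^{\beta_2}u(t)\big),\qquad 0\le t\le T,\tag{p1}$$ $$\begin{cases} a_0u(0)+b_0u(T)=\lambda_0\int_0^Tg_0(s,u(s))\,ds,\\ a_1\mathfrak D^{\beta_1}u(\eta)+b_1\mathfrak D^{\beta_1}u(T)=\lambda_1\int_0^Tg_1(s,u(s))\,ds,\\ a_2\mathfrak D^{\beta_2}u(\eta)+b_2\mathfrak D^{\beta_2}u(T)=\lambda_2\int_0^Tg_2(s,u(s))\,ds.\end{cases}\tag{p2}$$ A solution is a continuous function $u$ on $[0,T]$ such that $\mathfrak D^{\beta_1}u,\mathfrak D^{\beta_2}u,\mathfrak D^{\alpha}u$ exist and are continuous on $[0,T]$ and (p1), (p2) hold. Put $$\mu_i=\frac{\Gamma(3-\beta_i)}{2(a_i\eta^{2-\beta_i}+b_iT^{2-\beta_i})}\ (i=1,2),\qquad \nu=\frac{\Gamma(2-\beta_1)}{a_1\eta^{1-\beta_1}+b_1T^{1-\beta_1}},$$ $$\rho_0=\frac1{|a_0+b_0|},\qquad \rho_1=|\nu|\Big(\frac{|b_0|}{|a_0+b_0|}+1\Big)T,$$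 $$\rho_2=\frac{|b_0||\mu_2|}{|a_0+b_0|}T^2+\frac{|b_0||\nu|}{|a_0+b_0|}\frac{|\mu_2|}{|\mu_1|}T+\frac{|\nu||\mu_2|}{|\mu_1|}T+|\mu_2|T^2,$$ $$\tilde\rho_1=\frac{|\nu|T^{1-\beta_1}}{\Gamma(2-\beta_1)},\qquad \tilde\rho_2=\frac{|\mu_2||\nu|T^{1-\beta_1}}{|\mu_1|\Gamma(2-\beta_1)}+\frac{2|\mu_2|T^{2-\beta_1}}{\Gamma(3-\beta_1)},\qquad \hat\rho_2=\frac{2|\mu_2|T^{2-\beta_2}}{\Gamma(3-\beta_2)}.$$ For $0<\tau<\min(1,\alpha-\beta_2)$ and $i=0,1,2$ put $$\kappa_i=\Big(\frac{1-\tau}{\alpha-\beta_i-\tau}\Big)^{1-\tau},\qquad A_i=\frac{T^{\alpha-\beta_i-\tau}}{\Gamma(\alpha-\beta_i)}\kappa_i,\qquad B_i=\Big(|b_i|\frac{T^{\alpha-\beta_i-\tau}}{\Gamma(\alpha-\beta_i)}+|a_i|\frac{\eta^{\alpha-\beta_i-\tau}}{\Gamma(\alpha-\beta_i)}\Big)\kappa_i,$$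 $$\Delta_0=A_0+\sum_{i=0}^2\rho_iB_i,\qquad \Delta_1=A_1+\sum_{i=1}^2\tilde\rho_iB_i,\qquad \Delta_2=A_2+\hat\rho_2B_2.$$ **Theorem.** Assume: (H1) $f:[0,T]\times\mathbb R^3\to\mathbb R$ is jointly continuous. (H2) There are $\tau\in(0,\min(1,\alpha-\beta_2))$ and a nonnegative $l_f\in L^{1/\tau}([0,T])$ with $$|f(t,u_1,u_2,u_3)-f(t,v_1,v_2,v_3)|\le l_f(t)\big(|u_1-v_1|+|u_2-v_2|+|u_3-v_3|\big)$$ for all $t\in[0,T]$ and all $u_j,v_j\in\mathbb R$. (H3) For $i=0,1,2$, $g_i:[0,T]\times\mathbb R\to\mathbb R$ is jointly continuous and there is a nonnegative $l_{g_i}\in L^1([0,T])$ with $|g_i(t,u)-g_i(t,v)|\le l_{g_i}(t)|u-v|$ for all $t\in[0,T]$ and $u,v\in\mathbb R$. If $$(\Delta_0+\Delta_1+\Delta_2)\|l_f\|_{1/\tau}+\sum_{i=0}^2\rho_i|\lambda_i|\|l_{g_i}\|_1+\sum_{i=1}^2\tilde\rho_i|\lambda_i|\|l_{g_i}\|_1+\hat\rho_2|\lambda_2|\|l_{g_2}\|_1<1,$$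 then the problem (p1)–(p2) has a unique solution on $[0,T]$. -/

import Mathlib

open Set MeasureTheory

noncomputable section

/-- Riemann-Liouville fractional integral of order `ν ≥ 0` with base point `0`
(the identity when `ν = 0`). -/
def rlIntegral (ν : ℝ) (u : ℝ → ℝ) (t : ℝ) : ℝ :=
  if ν = 0 then u t
  else (Real.Gamma ν)⁻¹ * ∫ s in (0 : ℝ)..t, (t - s) ^ (ν - 1) * u s

/-- `u` minus its Taylor polynomial of degree `n - 1` at `0` (one-sided derivatives of `u`,
regarded as a function on `[0, T]`). -/
def taylorRemainder (T : ℝ) (n : ℕ) (u : ℝ → ℝ) (t : ℝ) : ℝ :=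
  u t - ∑ k ∈ Finset.range n,
    iteratedDerivWithin k u (Icc 0 T) 0 / (k.factorial : ℝ) * t ^ k

/-- Caputo derivative of order `γ > 0` on `[0, T]`: with `n = ⌈γ⌉`, the Riemann-Liouville
derivative `dⁿ/dtⁿ I^{n-γ}` of `u` minus its Taylor polynomial of degree `n - 1` at `0`.
For `u` of class `Cⁿ` it is `I^{n-γ} u⁽ⁿ⁾`, and for `γ = n` it is `u⁽ⁿ⁾`. -/
def caputoDeriv (T γ : ℝ) (u : ℝ → ℝ) (t : ℝ) : ℝ :=
  iteratedDerivWithin ⌈γ⌉₊ (rlIntegral ((⌈γ⌉₊ : ℝ) - γ) (taylorRemainder T ⌈γ⌉₊ u)) (Icc 0 T) t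

/-- The Caputo derivative of order `γ > 0` of `u` exists on `[0, T]` and is continuous there:
the Taylor polynomial makes sense (`u ∈ C^{n-1}[0, T]`) and the outer `n`-fold derivative in
`caputoDeriv` exists and is continuous. -/
def HasContCaputoDeriv (T γ : ℝ) (u : ℝ → ℝ) : Prop :=
  ContDiffOn ℝ ((⌈γ⌉₊ - 1 : ℕ) : WithTop ℕ∞) u (Icc 0 T) ∧
  ContDiffOn ℝ (⌈γ⌉₊ : WithTop ℕ∞)
    (rlIntegral ((⌈γ⌉₊ : ℝ) - γ) (taylorRemainder T ⌈γ⌉₊ u)) (Icc 0 T)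

/-- Data of the boundary value problem. Only the values of `f` and `g i` at times in `[0, T]`
are ever used. -/
structure FracBVP where
  (T η α β₁ β₂ : ℝ)
  (a b lam : Fin 3 → ℝ)
  f : ℝ → ℝ → ℝ → ℝ → ℝ
  g : Fin 3 → ℝ → ℝ → ℝ

namespace FracBVP

/-- The space `C_β([0, T]; ℝ)` of continuous functions with continuous Caputo derivatives of
orders `β₁` and `β₂`. -/
def MemCβ (P : FracBVP) (u : ℝ → ℝ) : Prop :=
  ContinuousOn u (Icc 0 P.T) ∧ HasContCaputoDeriv P.T P.β₁ u ∧ HasContCaputoDeriv P.T P.β₂ u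

/-- `u` solves the boundary value problem on `[0, T]`. -/
structure IsSolution (P : FracBVP) (u : ℝ → ℝ) : Prop where
  mem : P.MemCβ u
  diff : HasContCaputoDeriv P.T P.α u
  eqn : ∀ t ∈ Icc 0 P.T,
    caputoDeriv P.T P.α u t =
      P.f t (u t) (caputoDeriv P.T P.β₁ u t) (caputoDeriv P.T P.β₂ u t)
  bc0 : P.a 0 * u 0 + P.b 0 * u P.T = P.lam 0 * ∫ s in (0 : ℝ)..P.T, P.g 0 s (u s)
  bc1 : P.a 1 * caputoDeriv P.T P.β₁ u P.η + P.b 1 * caputoDeriv P.T P.β₁ u P.T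
    = P.lam 1 * ∫ s in (0 : ℝ)..P.T, P.g 1 s (u s)
  bc2 : P.a 2 * caputoDeriv P.T P.β₂ u P.η + P.b 2 * caputoDeriv P.T P.β₂ u P.T
    = P.lam 2 * ∫ s in (0 : ℝ)..P.T, P.g 2 s (u s)

/-- The orders `β₀ = 0`, `β₁`, `β₂`. -/
def β (P : FracBVP) : Fin 3 → ℝ := ![0, P.β₁, P.β₂]

/-- `μ^{β₁}` (for `i = 1`) and `μ^{β₂}` (for `i = 2`). -/
def mu (P : FracBVP) (i : Fin 3) : ℝ :=
  Real.Gamma (3 - P.β i) / (2 * (P.a i * P.η ^ (2 - P.β i) + P.b i * P.T ^ (2 - P.β i)))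

/-- `ν^{β₁}`. -/
def nu (P : FracBVP) : ℝ :=
  Real.Gamma (2 - P.β₁) / (P.a 1 * P.η ^ (1 - P.β₁) + P.b 1 * P.T ^ (1 - P.β₁))

def rho (P : FracBVP) : Fin 3 → ℝ :=
  ![1 / |P.a 0 + P.b 0|,
    |P.nu| * (|P.b 0| / |P.a 0 + P.b 0| + 1) * P.T,
    |P.b 0| * |P.mu 2| / |P.a 0 + P.b 0| * P.T ^ 2
      + |P.b 0| * |P.nu| / |P.a 0 + P.b 0| * (|P.mu 2| / |P.mu 1|) * P.T
      + |P.nu| * |P.mu 2| / |P.mu 1| * P.T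
      + |P.mu 2| * P.T ^ 2]

def rhoTilde (P : FracBVP) : Fin 3 → ℝ :=
  ![0,
    |P.nu| * P.T ^ (1 - P.β₁) / Real.Gamma (2 - P.β₁),
    |P.mu 2| * |P.nu| * P.T ^ (1 - P.β₁) / (|P.mu 1| * Real.Gamma (2 - P.β₁))
      + 2 * (|P.mu 2| * P.T ^ (2 - P.β₁) / Real.Gamma (3 - P.β₁))]

def rhoHat (P : FracBVP) : Fin 3 → ℝ :=
  ![0, 0, 2 * (|P.mu 2| * P.T ^ (2 - P.β₂) / Real.Gamma (3 - P.β₂))]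

/-- `((1 - τ) / (α - β_i - τ))^{1 - τ}`. -/
def holderFactor (P : FracBVP) (τ : ℝ) (i : Fin 3) : ℝ :=
  ((1 - τ) / (P.α - P.β i - τ)) ^ (1 - τ)

/-- `T^{α - β_i - τ} / Γ(α - β_i) * ((1 - τ) / (α - β_i - τ))^{1 - τ}`. -/
def interiorTerm (P : FracBVP) (τ : ℝ) (i : Fin 3) : ℝ :=
  P.T ^ (P.α - P.β i - τ) / Real.Gamma (P.α - P.β i) * P.holderFactor τ i

/-- The coefficient of `ρ_i` (or `ρ̃_i`, `ρ̂_i`) in the constants `Δ_j`. -/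
def boundaryTerm (P : FracBVP) (τ : ℝ) (i : Fin 3) : ℝ :=
  (|P.b i| * (P.T ^ (P.α - P.β i - τ) / Real.Gamma (P.α - P.β i))
    + |P.a i| * (P.η ^ (P.α - P.β i - τ) / Real.Gamma (P.α - P.β i))) * P.holderFactor τ i

def Delta0 (P : FracBVP) (τ : ℝ) : ℝ :=
  P.interiorTerm τ 0 + ∑ i : Fin 3, P.rho i * P.boundaryTerm τ i

def Delta1 (P : FracBVP) (τ : ℝ) : ℝ :=
  P.interiorTerm τ 1 + (P.rhoTilde 1 * P.boundaryTerm τ 1 + P.rhoTilde 2 * P.boundaryTerm τ 2)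

def Delta2 (P : FracBVP) (τ : ℝ) : ℝ :=
  P.interiorTerm τ 2 + P.rhoHat 2 * P.boundaryTerm τ 2

/-- The norm of `L^p([0, T])`, as a real number. -/
def normLp (P : FracBVP) (p : ℝ) (l : ℝ → ℝ) : ℝ :=
  (eLpNorm l (ENNReal.ofReal p) (volume.restrict (Icc 0 P.T))).toReal

end FracBVP

end

noncomputable section

/-! The problem is equivalent to a fixed-point equation for a contraction.

Everything rests on the semigroup law `I^μ I^ν = I^{μ+ν}` on continuous functions
(`rlIntegral_rlIntegral`). It gives the fundamental theorem of fractional calculus in both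
directions: if the Taylor remainder of `u` is `I^γ y`, then `y` is the Caputo derivative
(`caputo_of_taylorRemainder_eq`), and conversely the remainder is `I^γ` of that derivative
(`taylorRemainder_eq_rlIntegral_caputoDeriv`). The converse needs care, since `u` is only known to
be `C^{n-1}`.

So `𝔇^α u = y` means `u = d₀ + d₁ t + d₂ t²/2 + I^α y`, and `𝔇^{β₁} u`, `𝔇^{β₂} u` have similar
closed forms in `d` and `y` (`profile`). The boundary conditions become a triangular linear system
for `d`, uniquely solvable by the nondegeneracy assumptions (`boundary_iff_eq_coef`). With `y = f(t,
u, 𝔇^{β₁} u, 𝔇^{β₂} u)`, solutions correspond to continuous triples fixed by `op`. The three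
components may be treated as independent unknowns, because at a fixed point the last two are forced
to be the Caputo derivatives of the first.

Hölder's inequality with exponents `1/τ` and `1/(1-τ)` bounds `I^{α-β_i}` of a difference of
right-hand sides (`abs_rlIntegral_le_holder`). This yields a Lipschitz constant for each component
of `op` (`abs_op_sub_le`). In the ℓ¹ product of sup norms the constants add up to the left side of
the smallness condition, and Banach's theorem applies. -/

/-! ### Riemann-Liouville integrals: linearity, bounds, continuity -/

theorem rlIntegral_zero_order (u : ℝ → ℝ) : rlIntegral 0 u = u := by
  funext t
  simp [rlIntegral]

theorem rlIntegral_of_pos {ν : ℝ} (hν : 0 < ν) (u : ℝ → ℝ) (t : ℝ) :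
    rlIntegral ν u t = (Real.Gamma ν)⁻¹ * ∫ s in (0 : ℝ)..t, (t - s) ^ (ν - 1) * u s := by
  simp [rlIntegral, hν.ne']

theorem rlIntegral_apply_zero {ν : ℝ} (hν : 0 < ν) (u : ℝ → ℝ) : rlIntegral ν u 0 = 0 := by
  simp [rlIntegral_of_pos hν]

theorem rlIntegral_one_order (u : ℝ → ℝ) (t : ℝ) :
    rlIntegral 1 u t = ∫ s in (0 : ℝ)..t, u s := by
  simp [rlIntegral_of_pos one_pos]

theorem rlIntegral_congr {T ν : ℝ} {u v : ℝ → ℝ} (h : EqOn u v (Icc 0 T)) :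
    EqOn (rlIntegral ν u) (rlIntegral ν v) (Icc 0 T) := by
  intro t ht
  simp only [rlIntegral]
  split_ifs with h0
  · exact h ht
  · congr 1
    refine intervalIntegral.integral_congr fun s hs => ?_
    rw [uIcc_of_le ht.1] at hs
    simp only [h ⟨hs.1, hs.2.trans ht.2⟩]

theorem intervalIntegrable_sub_rpow {ν : ℝ} (hν : 0 < ν) (t : ℝ) :
    IntervalIntegrable (fun s => (t - s) ^ (ν - 1)) volume 0 t := by
  have h := (intervalIntegral.intervalIntegrable_rpow' (a := 0) (b := t)
    (show -1 < ν - 1 by linarith)).comp_sub_left t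
  simpa using h.symm

theorem integral_sub_rpow {ν : ℝ} (hν : 0 < ν) (t : ℝ) :
    ∫ s in (0 : ℝ)..t, (t - s) ^ (ν - 1) = t ^ ν / ν := by
  rw [intervalIntegral.integral_comp_sub_left (fun s => s ^ (ν - 1)) t]
  rw [sub_self, sub_zero, integral_rpow (Or.inl (by linarith))]
  simp [Real.zero_rpow hν.ne']

theorem intervalIntegrable_rlIntegral {T ν t : ℝ} (hν : 0 < ν) {u : ℝ → ℝ}
    (hu : ContinuousOn u (Icc 0 T)) (ht : t ∈ Icc 0 T) :
    IntervalIntegrable (fun s => (t - s) ^ (ν - 1) * u s) volume 0 t :=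
  (intervalIntegrable_sub_rpow hν t).mul_continuousOn
    (hu.mono (by rw [uIcc_of_le ht.1]; exact Icc_subset_Icc le_rfl ht.2))

theorem rlIntegral_add {T ν : ℝ} (hν : 0 ≤ ν) {u v : ℝ → ℝ} (hu : ContinuousOn u (Icc 0 T))
    (hv : ContinuousOn v (Icc 0 T)) {t : ℝ} (ht : t ∈ Icc 0 T) :
    rlIntegral ν (fun s => u s + v s) t = rlIntegral ν u t + rlIntegral ν v t := by
  rcases hν.eq_or_lt with rfl | hν
  · simp [rlIntegral]
  simp only [rlIntegral_of_pos hν]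
  rw [← mul_add, ← intervalIntegral.integral_add (intervalIntegrable_rlIntegral hν hu ht)
    (intervalIntegrable_rlIntegral hν hv ht)]
  simp only [mul_add]

theorem rlIntegral_const_mul (ν c : ℝ) (u : ℝ → ℝ) (t : ℝ) :
    rlIntegral ν (fun s => c * u s) t = c * rlIntegral ν u t := by
  simp only [rlIntegral]
  split_ifs
  · rfl
  · rw [mul_left_comm c, ← intervalIntegral.integral_const_mul c]
    congr 2
    funext s
    ring

theorem rlIntegral_sub {T ν : ℝ} (hν : 0 ≤ ν) {u v : ℝ → ℝ} (hu : ContinuousOn u (Icc 0 T))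
    (hv : ContinuousOn v (Icc 0 T)) {t : ℝ} (ht : t ∈ Icc 0 T) :
    rlIntegral ν (fun s => u s - v s) t = rlIntegral ν u t - rlIntegral ν v t := by
  have h := rlIntegral_add hν hu (hv.const_mul (-1)) ht
  rw [rlIntegral_const_mul] at h
  rw [← sub_eq_zero] at h ⊢
  rw [← h]
  simp only [neg_one_mul, ← sub_eq_add_neg]

/-- `I^ν 1` at `t ≥ 0` is `t^ν / Γ(ν + 1)`. -/
theorem rlIntegral_one {ν : ℝ} (hν : 0 ≤ ν) (t : ℝ) :
    rlIntegral ν (fun _ => 1) t = t ^ ν / Real.Gamma (ν + 1) := by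
  rcases hν.eq_or_lt with rfl | hν
  · simp [rlIntegral]
  · simp only [rlIntegral_of_pos hν, mul_one]
    rw [integral_sub_rpow hν, Real.Gamma_add_one hν.ne']
    have := (Real.Gamma_pos_of_pos hν).ne'
    field_simp

theorem abs_rlIntegral_le_rlIntegral {T ν : ℝ} (hν : 0 ≤ ν) {u v : ℝ → ℝ}
    (hv : ContinuousOn v (Icc 0 T))
    (h : ∀ s ∈ Icc 0 T, |u s| ≤ v s) {t : ℝ} (ht : t ∈ Icc 0 T) :
    |rlIntegral ν u t| ≤ rlIntegral ν v t := by
  rcases hν.eq_or_lt with rfl | hν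
  · simpa [rlIntegral] using h t ht
  simp only [rlIntegral_of_pos hν]
  have hΓ := Real.Gamma_pos_of_pos hν
  rw [abs_mul, abs_of_pos (inv_pos.2 hΓ)]
  refine mul_le_mul_of_nonneg_left ?_ (inv_pos.2 hΓ).le
  rw [← Real.norm_eq_abs]
  refine intervalIntegral.norm_integral_le_of_norm_le ht.1 (ae_of_all _ fun s hs => ?_)
    (intervalIntegrable_rlIntegral hν hv ht)
  have h0 : 0 ≤ (t - s) ^ (ν - 1) := Real.rpow_nonneg (by linarith [hs.2]) _
  rw [Real.norm_eq_abs, abs_mul, abs_of_nonneg h0]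
  exact mul_le_mul_of_nonneg_left (h s ⟨hs.1.le, hs.2.trans ht.2⟩) h0

theorem abs_rlIntegral_le {T ν M : ℝ} (hν : 0 ≤ ν) {u : ℝ → ℝ}
    (h : ∀ s ∈ Icc 0 T, |u s| ≤ M) {t : ℝ} (ht : t ∈ Icc 0 T) :
    |rlIntegral ν u t| ≤ M * (t ^ ν / Real.Gamma (ν + 1)) := by
  have h1 := abs_rlIntegral_le_rlIntegral hν (v := fun _ => M * 1) continuousOn_const
    (by simpa using h) ht
  rwa [rlIntegral_const_mul, rlIntegral_one hν] at h1

/-- The substitution `s = t x` removes `t` from the limits and the singular kernel, leaving it only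
in `t ^ ν` and in the argument of `u`. -/
theorem rlIntegral_eq_scaled {ν t : ℝ} (hν : 0 < ν) (ht : 0 ≤ t) (u : ℝ → ℝ) :
    rlIntegral ν u t =
      (Real.Gamma ν)⁻¹ * (t ^ ν * ∫ x in (0 : ℝ)..1, (1 - x) ^ (ν - 1) * u (t * x)) := by
  rw [rlIntegral_of_pos hν]
  congr 1
  have h := intervalIntegral.mul_integral_comp_mul_left (a := 0) (b := 1) (c := t)
    (f := fun s => (t - s) ^ (ν - 1) * u s)
  rw [mul_zero, mul_one] at h
  rw [← h]
  rcases ht.eq_or_lt with rfl | ht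
  · simp [Real.zero_rpow hν.ne']
  · rw [← intervalIntegral.integral_const_mul, ← intervalIntegral.integral_const_mul]
    refine intervalIntegral.integral_congr fun x hx => ?_
    rw [uIcc_of_le zero_le_one] at hx
    have h1 : t - t * x = t * (1 - x) := by ring
    rw [h1, Real.mul_rpow ht.le (by linarith [hx.2]), Real.rpow_sub_one ht.ne']
    field_simp

/-- In the scaled form dominated convergence applies, with majorant `M (1 - x)^(ν - 1)`. Extending
`u` by constants outside `[0, T]` makes the integrand continuous and bounded for every real `t`. -/
theorem continuousOn_rlIntegral {T ν : ℝ} (hν : 0 ≤ ν) {u : ℝ → ℝ}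
    (hu : ContinuousOn u (Icc 0 T)) : ContinuousOn (rlIntegral ν u) (Icc 0 T) := by
  rcases hν.eq_or_lt with rfl | hν
  · rwa [rlIntegral_zero_order]
  rcases lt_or_ge T 0 with hT | hT
  · simp [Icc_eq_empty_of_lt hT]
  obtain ⟨M, hM⟩ := isCompact_Icc.exists_bound_of_continuousOn hu
  set v : ℝ → ℝ := IccExtend hT ((Icc 0 T).domRestrict u) with hv
  have hvc : Continuous v := (continuousOn_iff_continuous_domRestrict.1 hu).Icc_extend'
  have hvM : ∀ s, ‖v s‖ ≤ M := fun s => by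
    rw [hv, IccExtend_apply]
    exact hM _ (Subtype.property _)
  have huv : EqOn u v (Icc 0 T) := fun s hs => by
    rw [hv, IccExtend_of_mem _ _ hs, domRestrict_apply]
  have hbi : IntervalIntegrable (fun x : ℝ => (1 - x) ^ (ν - 1)) volume 0 1 :=
    intervalIntegrable_sub_rpow hν 1
  have hc : Continuous fun t => ∫ x in (0 : ℝ)..1, (1 - x) ^ (ν - 1) * v (t * x) := by
    refine intervalIntegral.continuous_of_dominated_interval
      (bound := fun x => (1 - x) ^ (ν - 1) * M) (fun t => ?_) (fun t => ae_of_all _ fun x hx => ?_)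
      (hbi.mul_const M) (ae_of_all _ fun x _ => by fun_prop)
    · rw [uIoc_of_le zero_le_one]
      exact hbi.1.aestronglyMeasurable.mul (by fun_prop)
    · rw [uIoc_of_le zero_le_one] at hx
      have h0 : 0 ≤ (1 - x) ^ (ν - 1) := Real.rpow_nonneg (by linarith [hx.2]) _
      rw [norm_mul, Real.norm_of_nonneg h0]
      exact mul_le_mul_of_nonneg_left (hvM _) h0
  have hc2 : Continuous fun t : ℝ => (Real.Gamma ν)⁻¹ *
      (t ^ ν * ∫ x in (0 : ℝ)..1, (1 - x) ^ (ν - 1) * v (t * x)) :=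
    continuous_const.mul ((Real.continuous_rpow_const hν.le).mul hc)
  refine hc2.continuousOn.congr fun t ht => ?_
  rw [rlIntegral_congr huv ht, rlIntegral_eq_scaled hν ht.1]

/-! ### Power functions and the semigroup law -/

/-- This is the Beta integral `B(p + 1, ν)`; on `[0, 1]` the complex integrand is the cast of the
real one. -/
theorem integral_rpow_mul_one_sub_rpow {p ν : ℝ} (hp : 0 ≤ p) (hν : 0 < ν) :
    ∫ x in (0 : ℝ)..1, (1 - x) ^ (ν - 1) * x ^ p =
      Real.Gamma ν * Real.Gamma (p + 1) / Real.Gamma (p + 1 + ν) := by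
  have h := ProbabilityTheory.beta_eq_betaIntegralReal (p + 1) ν (by linarith) hν
  rw [ProbabilityTheory.beta, Complex.betaIntegral] at h
  rw [mul_comm (Real.Gamma ν), h]
  have h2 : ∫ x in (0 : ℝ)..1, (x : ℂ) ^ (((p + 1 : ℝ) : ℂ) - 1) * (1 - (x : ℂ)) ^ ((ν : ℂ) - 1) =
      ∫ x in (0 : ℝ)..1, (((1 - x) ^ (ν - 1) * x ^ p : ℝ) : ℂ) := by
    refine intervalIntegral.integral_congr fun x hx => ?_
    rw [uIcc_of_le zero_le_one] at hx
    push_cast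
    rw [Complex.ofReal_cpow (by linarith [hx.2]), Complex.ofReal_cpow hx.1]
    push_cast
    rw [add_sub_cancel_right, mul_comm]
  rw [h2, intervalIntegral.integral_ofReal, Complex.ofReal_re]

theorem rlIntegral_rpow {p ν t : ℝ} (hp : 0 ≤ p) (hν : 0 ≤ ν) (ht : 0 ≤ t) :
    rlIntegral ν (fun s => s ^ p) t =
      Real.Gamma (p + 1) / Real.Gamma (p + ν + 1) * t ^ (p + ν) := by
  rcases hν.eq_or_lt with rfl | hν
  · have := (Real.Gamma_pos_of_pos (show 0 < p + 1 by linarith)).ne'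
    simp [rlIntegral, this]
  rw [rlIntegral_eq_scaled hν ht]
  have h : ∫ x in (0 : ℝ)..1, (1 - x) ^ (ν - 1) * (t * x) ^ p =
      t ^ p * ∫ x in (0 : ℝ)..1, (1 - x) ^ (ν - 1) * x ^ p := by
    rw [← intervalIntegral.integral_const_mul]
    refine intervalIntegral.integral_congr fun x hx => ?_
    rw [uIcc_of_le zero_le_one] at hx
    rw [Real.mul_rpow ht hx.1]
    ring
  rw [h, integral_rpow_mul_one_sub_rpow hp hν, Real.rpow_add_of_nonneg ht hp hν.le,
    show p + ν + 1 = p + 1 + ν by ring]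
  have := (Real.Gamma_pos_of_pos hν).ne'
  field_simp

/-- Each integration of a power produces a quotient of Gamma values, and `Γ(p + ν + 1)` cancels
between the two. -/
theorem rlIntegral_rlIntegral_rpow {T p μ ν t : ℝ} (hp : 0 ≤ p) (hμ : 0 ≤ μ) (hν : 0 ≤ ν)
    (ht : t ∈ Icc 0 T) :
    rlIntegral μ (rlIntegral ν fun s => s ^ p) t = rlIntegral (μ + ν) (fun s => s ^ p) t := by
  rw [rlIntegral_congr (T := T) (v := fun s => Real.Gamma (p + 1) / Real.Gamma (p + ν + 1) *
    s ^ (p + ν)) (fun s hs => rlIntegral_rpow hp hν hs.1) ht, rlIntegral_const_mul,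
    rlIntegral_rpow (by linarith) hμ ht.1, rlIntegral_rpow hp (by linarith) ht.1,
    show p + (μ + ν) = p + ν + μ by ring]
  have := (Real.Gamma_pos_of_pos (show 0 < p + ν + 1 by linarith)).ne'
  field_simp

theorem rlIntegral_rlIntegral_polynomial {T μ ν : ℝ} (hμ : 0 ≤ μ) (hν : 0 ≤ ν)
    (p : Polynomial ℝ) {t : ℝ} (ht : t ∈ Icc 0 T) :
    rlIntegral μ (rlIntegral ν fun s => p.eval s) t =
      rlIntegral (μ + ν) (fun s => p.eval s) t := by
  induction p using Polynomial.induction_on' with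
  | add p q hp hq =>
    have hpc : ContinuousOn (fun s => p.eval s) (Icc 0 T) := p.continuous.continuousOn
    have hqc : ContinuousOn (fun s => q.eval s) (Icc 0 T) := q.continuous.continuousOn
    simp only [Polynomial.eval_add]
    rw [rlIntegral_congr (T := T) (fun s hs => rlIntegral_add hν hpc hqc hs) ht,
      rlIntegral_add hμ (continuousOn_rlIntegral hν hpc) (continuousOn_rlIntegral hν hqc) ht,
      rlIntegral_add (add_nonneg hμ hν) hpc hqc ht, hp, hq]
  | monomial n a =>
    have h : ∀ κ, rlIntegral κ (fun s => (Polynomial.monomial n a).eval s) =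
        fun t => a * rlIntegral κ (fun s => s ^ (n : ℝ)) t := fun κ => by
      funext t
      rw [← rlIntegral_const_mul]
      simp
    rw [h, h, rlIntegral_const_mul, rlIntegral_rlIntegral_rpow n.cast_nonneg hμ hν ht]

/-- Semigroup law of the Riemann-Liouville integrals on continuous functions. -/
theorem rlIntegral_rlIntegral {T μ ν : ℝ} (hμ : 0 ≤ μ) (hν : 0 ≤ ν) {u : ℝ → ℝ}
    (hu : ContinuousOn u (Icc 0 T)) :
    EqOn (rlIntegral μ (rlIntegral ν u)) (rlIntegral (μ + ν) u) (Icc 0 T) := by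
  intro t ht
  have hT : 0 ≤ T := ht.1.trans ht.2
  have hμν : 0 ≤ μ + ν := add_nonneg hμ hν
  set C₁ := T ^ ν / Real.Gamma (ν + 1)
  set C₂ := t ^ μ / Real.Gamma (μ + 1)
  set C₃ := t ^ (μ + ν) / Real.Gamma (μ + ν + 1)
  have hΓ : ∀ x : ℝ, 0 ≤ x → 0 < Real.Gamma (x + 1) := fun x hx =>
    Real.Gamma_pos_of_pos (by linarith)
  have hC₁ : 0 ≤ C₁ := div_nonneg (Real.rpow_nonneg hT _) (hΓ _ hν).le
  have hC₂ : 0 ≤ C₂ := div_nonneg (Real.rpow_nonneg ht.1 _) (hΓ _ hμ).le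
  have hC₃ : 0 ≤ C₃ := div_nonneg (Real.rpow_nonneg ht.1 _) (hΓ _ hμν).le
  -- Weierstrass: both sides are bounded linear in `u` for the sup norm and agree on polynomials.
  -- Approximating `u` within `ε` costs `C₁ C₂ ε` on the iterated side and `C₃ ε` on the other.
  have key : ∀ ε > 0, |rlIntegral μ (rlIntegral ν u) t - rlIntegral (μ + ν) u t| ≤
      (C₁ * C₂ + C₃) * ε := by
    intro ε hε
    obtain ⟨p, hp⟩ := exists_polynomial_near_of_continuousOn 0 T u hu ε hε
    have hpc : ContinuousOn (fun s => p.eval s) (Icc 0 T) := p.continuous.continuousOn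
    have h1 : ∀ s ∈ Icc 0 T, |rlIntegral ν (fun s => p.eval s) s - rlIntegral ν u s| ≤ ε * C₁ := by
      intro s hs
      rw [← rlIntegral_sub hν hpc hu hs]
      refine (abs_rlIntegral_le hν (fun r hr => (hp r hr).le) hs).trans ?_
      exact mul_le_mul_of_nonneg_left
        (div_le_div_of_nonneg_right (Real.rpow_le_rpow hs.1 hs.2 hν) (hΓ _ hν).le) hε.le
    have h2 := abs_rlIntegral_le hμ h1 ht
    rw [rlIntegral_sub hμ (continuousOn_rlIntegral hν hpc) (continuousOn_rlIntegral hν hu) ht,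
      rlIntegral_rlIntegral_polynomial hμ hν p ht] at h2
    have h3 := abs_rlIntegral_le hμν (fun r hr => (hp r hr).le) ht
    rw [rlIntegral_sub hμν hpc hu ht] at h3
    rw [abs_le] at h2 h3 ⊢
    constructor <;> linarith
  by_contra hne
  have hpos : 0 < |rlIntegral μ (rlIntegral ν u) t - rlIntegral (μ + ν) u t| :=
    abs_pos.2 (sub_ne_zero.2 hne)
  -- The summand 1 is needed because `C₁ * C₂ + C₃` may vanish, as at `t = 0` with `μ > 0`.
  have hC : 0 < C₁ * C₂ + C₃ + 1 := by positivity
  have h := key _ (div_pos hpos hC)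
  rw [mul_div_assoc', le_div_iff₀ hC] at h
  nlinarith

/-! ### Derivatives of fractional integrals -/

/-- By the semigroup law `I^{ν+1} u` is the primitive of the continuous function `I^ν u`. Extending
the latter by constants makes the primitive differentiable from both sides, endpoints included. -/
theorem hasDerivWithinAt_rlIntegral {T ν : ℝ} (hν : 0 ≤ ν) {u : ℝ → ℝ}
    (hu : ContinuousOn u (Icc 0 T)) {t : ℝ} (ht : t ∈ Icc 0 T) :
    HasDerivWithinAt (rlIntegral (ν + 1) u) (rlIntegral ν u t) (Icc 0 T) t := by
  have hT : 0 ≤ T := ht.1.trans ht.2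
  have hc := continuousOn_rlIntegral hν hu
  set v : ℝ → ℝ := IccExtend hT ((Icc 0 T).domRestrict (rlIntegral ν u)) with hv
  have hvc : Continuous v := (continuousOn_iff_continuous_domRestrict.1 hc).Icc_extend'
  have huv : EqOn v (rlIntegral ν u) (Icc 0 T) := fun s hs => by
    rw [hv, IccExtend_of_mem _ _ hs, domRestrict_apply]
  have h1 : HasDerivAt (fun t => ∫ s in (0 : ℝ)..t, v s) (v t) t :=
    intervalIntegral.integral_hasDerivAt_right (hvc.intervalIntegrable _ _)
      (hvc.stronglyMeasurableAtFilter _ _) hvc.continuousAt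
  rw [huv ht] at h1
  refine h1.hasDerivWithinAt.congr_of_mem (fun s hs => ?_) ht
  rw [add_comm, ← rlIntegral_rlIntegral zero_le_one hν hu hs, ← rlIntegral_congr huv hs,
    rlIntegral_one_order]

/-- A chain of successive derivatives on `[0, T]` computes the iterated derivatives. -/
theorem iteratedDerivWithin_eq_of_chain {T : ℝ} (hT : 0 < T) {n : ℕ} {F : ℕ → ℝ → ℝ}
    (h : ∀ k < n, ∀ t ∈ Icc 0 T, HasDerivWithinAt (F k) (F (k + 1) t) (Icc 0 T) t) :
    ∀ k ≤ n, EqOn (iteratedDerivWithin k (F 0) (Icc 0 T)) (F k) (Icc 0 T) := by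
  intro k
  induction k with
  | zero => intro _ t _; simp
  | succ k ih =>
    intro hk t ht
    rw [iteratedDerivWithin_succ, derivWithin_congr (ih (by omega)) (ih (by omega) ht)]
    exact (h k (by omega) t ht).derivWithin (uniqueDiffOn_Icc hT t ht)

theorem contDiffOn_of_chain {T : ℝ} (hT : 0 < T) {n : ℕ} {F : ℕ → ℝ → ℝ}
    (h : ∀ k < n, ∀ t ∈ Icc 0 T, HasDerivWithinAt (F k) (F (k + 1) t) (Icc 0 T) t)
    (hn : ContinuousOn (F n) (Icc 0 T)) : ContDiffOn ℝ n (F 0) (Icc 0 T) := by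
  have he := iteratedDerivWithin_eq_of_chain hT h
  rw [contDiffOn_nat_iff_continuousOn_differentiableOn_deriv (uniqueDiffOn_Icc hT)]
  constructor
  · intro m hm
    rcases hm.eq_or_lt with rfl | hm'
    · exact hn.congr (he _ le_rfl)
    · exact ContinuousOn.congr (fun t ht => (h m hm' t ht).continuousWithinAt) (he m hm)
  · intro m hm t ht
    exact ((h m hm t ht).differentiableWithinAt).congr (he m hm.le) (he m hm.le ht)

/-- One link of the chain `I^{n+ν} u, I^{n-1+ν} u, …, I^ν u`; `k < n` keeps the natural subtraction
exact. -/
theorem hasDerivWithinAt_rlIntegral_natSub {T ν : ℝ} (hν : 0 ≤ ν) {u : ℝ → ℝ}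
    (hu : ContinuousOn u (Icc 0 T)) {n k : ℕ} (hk : k < n) {t : ℝ} (ht : t ∈ Icc 0 T) :
    HasDerivWithinAt (rlIntegral (((n - k : ℕ) : ℝ) + ν) u)
      (rlIntegral (((n - (k + 1) : ℕ) : ℝ) + ν) u t) (Icc 0 T) t := by
  have h := hasDerivWithinAt_rlIntegral (add_nonneg (Nat.cast_nonneg (n - (k + 1))) hν) hu ht
  rwa [add_right_comm, ← Nat.cast_add_one, show n - (k + 1) + 1 = n - k by omega] at h

/-- `I^{n+ν} u` is of class `Cⁿ`. -/
theorem contDiffOn_rlIntegral {T ν : ℝ} (hT : 0 < T) (hν : 0 ≤ ν) {u : ℝ → ℝ}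
    (hu : ContinuousOn u (Icc 0 T)) (n : ℕ) :
    ContDiffOn ℝ n (rlIntegral (n + ν) u) (Icc 0 T) := by
  have h := contDiffOn_of_chain hT (n := n) (F := fun k => rlIntegral (((n - k : ℕ) : ℝ) + ν) u)
    (fun k hk t ht => hasDerivWithinAt_rlIntegral_natSub hν hu hk ht)
    (continuousOn_rlIntegral (add_nonneg (Nat.cast_nonneg _) hν) hu)
  simpa using h

theorem iteratedDerivWithin_rlIntegral {T ν : ℝ} (hT : 0 < T) (hν : 0 ≤ ν) {u : ℝ → ℝ}
    (hu : ContinuousOn u (Icc 0 T)) {n k : ℕ} (hk : k ≤ n) :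
    EqOn (iteratedDerivWithin k (rlIntegral (n + ν) u) (Icc 0 T))
      (rlIntegral (((n - k : ℕ) : ℝ) + ν) u) (Icc 0 T) := by
  have h := iteratedDerivWithin_eq_of_chain hT (n := n)
    (F := fun k => rlIntegral (((n - k : ℕ) : ℝ) + ν) u)
    (fun k hk t ht => hasDerivWithinAt_rlIntegral_natSub hν hu hk ht) k hk
  simpa using h

/-! ### Taylor's formula -/

/-- `I^k 1 = t^k / k!`. -/
theorem rlIntegral_natCast_one (k : ℕ) (t : ℝ) :
    rlIntegral k (fun _ => 1) t = t ^ k / (k.factorial : ℝ) := by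
  rw [rlIntegral_one k.cast_nonneg, Real.Gamma_nat_eq_factorial, Real.rpow_natCast]

/-- Fundamental theorem of calculus on `[0, T]`. -/
theorem eq_add_rlIntegral_one_derivWithin {T : ℝ} (hT : 0 < T) {u : ℝ → ℝ}
    (hu : ContDiffOn ℝ 1 u (Icc 0 T)) {t : ℝ} (ht : t ∈ Icc 0 T) :
    u t = u 0 + rlIntegral 1 (derivWithin u (Icc 0 T)) t := by
  have hd := hu.differentiableOn one_ne_zero
  have hc : ContinuousOn (derivWithin u (Icc 0 T)) (Icc 0 T) :=
    hu.continuousOn_derivWithin (uniqueDiffOn_Icc hT) le_rfl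
  rw [rlIntegral_one_order, intervalIntegral.integral_eq_sub_of_hasDeriv_right_of_le ht.1
    (hu.continuousOn.mono (Icc_subset_Icc le_rfl ht.2)) (fun x hx => ?_)
    ((hc.mono (Icc_subset_Icc le_rfl ht.2)).intervalIntegrable_of_Icc ht.1)]
  · ring
  · have hx' : x ∈ Ioo 0 T := ⟨hx.1, hx.2.trans_le ht.2⟩
    exact ((hd x (Ioo_subset_Icc_self hx')).hasDerivWithinAt.hasDerivAt
      (Icc_mem_nhds hx'.1 hx'.2)).hasDerivWithinAt

theorem continuousOn_sum_rlIntegral_one {T : ℝ} (m : ℕ) (c : ℕ → ℝ) :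
    ContinuousOn (fun t => ∑ k ∈ Finset.range m, c k * rlIntegral k (fun _ => 1) t)
      (Icc 0 T) :=
  continuousOn_finsetSum _ fun k _ =>
    (continuousOn_rlIntegral k.cast_nonneg continuousOn_const).const_mul (c k)

/-- Writing Taylor polynomials in the basis `I^k 1` instead of `t^k / k!` lets the semigroup law
handle them together with the remainder. -/
theorem rlIntegral_sum_rlIntegral_one {T ν : ℝ} (hν : 0 ≤ ν) (m : ℕ) (c : ℕ → ℝ) {t : ℝ}
    (ht : t ∈ Icc 0 T) :
    rlIntegral ν (fun t => ∑ k ∈ Finset.range m, c k * rlIntegral k (fun _ => 1) t) t =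
      ∑ k ∈ Finset.range m, c k * rlIntegral (ν + k) (fun _ => 1) t := by
  induction m with
  | zero => simpa using rlIntegral_const_mul ν 0 (fun _ => 0) t
  | succ m ih =>
    simp only [Finset.sum_range_succ]
    rw [rlIntegral_add hν (continuousOn_sum_rlIntegral_one m c)
      ((continuousOn_rlIntegral m.cast_nonneg continuousOn_const).const_mul _) ht, ih,
      rlIntegral_const_mul, rlIntegral_rlIntegral hν m.cast_nonneg continuousOn_const ht]

/-- Taylor's formula with fractional-integral remainder. -/
theorem taylor_rlIntegral {T : ℝ} (hT : 0 < T) (m : ℕ) :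
    ∀ {u : ℝ → ℝ}, ContDiffOn ℝ m u (Icc 0 T) → ∀ t ∈ Icc 0 T,
      u t = ∑ k ∈ Finset.range m,
        iteratedDerivWithin k u (Icc 0 T) 0 * rlIntegral k (fun _ => 1) t
        + rlIntegral m (iteratedDerivWithin m u (Icc 0 T)) t := by
  induction m with
  | zero => intro u _ t _; simp [rlIntegral_zero_order]
  | succ m ih =>
    intro u hu t ht
    have hud := uniqueDiffOn_Icc hT
    have hu' : ContDiffOn ℝ m (derivWithin u (Icc 0 T)) (Icc 0 T) :=
      hu.derivWithin hud (by norm_cast)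
    have hc : ContinuousOn (iteratedDerivWithin m (derivWithin u (Icc 0 T)) (Icc 0 T)) (Icc 0 T) :=
      hu'.continuousOn_iteratedDerivWithin le_rfl hud
    -- Taylor's formula for `u'` is inserted into `u = u(0) + I^1 u'`; applying `I^1` shifts every
    -- index by one.
    rw [eq_add_rlIntegral_one_derivWithin hT (hu.of_le (by norm_cast; omega)) ht,
      rlIntegral_congr (ih hu') ht, rlIntegral_add zero_le_one
        (continuousOn_sum_rlIntegral_one m _) (continuousOn_rlIntegral m.cast_nonneg hc) ht,
      rlIntegral_sum_rlIntegral_one zero_le_one m _ ht,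
      rlIntegral_rlIntegral zero_le_one m.cast_nonneg hc ht, Finset.sum_range_succ',
      iteratedDerivWithin_succ']
    simp only [iteratedDerivWithin_succ', iteratedDerivWithin_zero, Nat.cast_zero, mul_one,
      rlIntegral_zero_order, Nat.cast_add, Nat.cast_one, add_comm (1 : ℝ)]
    ring

/-! ### Caputo derivatives as inverses of fractional integrals -/

theorem taylorRemainder_eq (T : ℝ) (n : ℕ) (u : ℝ → ℝ) (t : ℝ) :
    taylorRemainder T n u t = u t - ∑ k ∈ Finset.range n,
      iteratedDerivWithin k u (Icc 0 T) 0 * rlIntegral k (fun _ => 1) t := by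
  simp only [taylorRemainder, rlIntegral_natCast_one]
  congr 1
  exact Finset.sum_congr rfl fun k _ => by ring

/-- If the Taylor remainder of `u` is `I^γ y` then `y` is the Caputo derivative of `u`. -/
theorem caputo_of_taylorRemainder_eq {T γ : ℝ} (hT : 0 < T) (hγ : 0 < γ) {u y : ℝ → ℝ}
    (hu : ContDiffOn ℝ ((⌈γ⌉₊ - 1 : ℕ) : WithTop ℕ∞) u (Icc 0 T))
    (hy : ContinuousOn y (Icc 0 T))
    (h : EqOn (taylorRemainder T ⌈γ⌉₊ u) (rlIntegral γ y) (Icc 0 T)) :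
    HasContCaputoDeriv T γ u ∧ EqOn (caputoDeriv T γ u) y (Icc 0 T) := by
  have hn : 0 ≤ (⌈γ⌉₊ : ℝ) - γ := sub_nonneg.2 (Nat.le_ceil γ)
  -- `I^{n-γ} I^γ y = I^n y`, whose `n`-th derivative is `y`; the order is written `n + 0` to fit
  -- the chain with `ν = 0`.
  have hW : EqOn (rlIntegral ((⌈γ⌉₊ : ℝ) - γ) (taylorRemainder T ⌈γ⌉₊ u))
      (rlIntegral (⌈γ⌉₊ + 0) y) (Icc 0 T) := by
    intro t ht
    rw [rlIntegral_congr h ht, rlIntegral_rlIntegral hn hγ.le hy ht, sub_add_cancel, add_zero]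
  refine ⟨⟨hu, (contDiffOn_rlIntegral hT le_rfl hy _).congr hW⟩, fun t ht => ?_⟩
  rw [caputoDeriv, iteratedDerivWithin_congr hW ht,
    iteratedDerivWithin_rlIntegral hT le_rfl hy le_rfl ht]
  simp [rlIntegral_zero_order]

/-- Injectivity of `I^ν` on continuous functions, for `ν ≤ 1`. -/
theorem eqOn_of_rlIntegral_eqOn {T ν : ℝ} (hT : 0 < T) (hν : 0 ≤ ν) (hν1 : ν ≤ 1)
    {u v : ℝ → ℝ} (hu : ContinuousOn u (Icc 0 T)) (hv : ContinuousOn v (Icc 0 T))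
    (h : EqOn (rlIntegral ν u) (rlIntegral ν v) (Icc 0 T)) : EqOn u v (Icc 0 T) := by
  -- Applying `I^{1-ν}` raises the order to 1, where differentiation recovers the function.
  have h1 : EqOn (rlIntegral 1 u) (rlIntegral 1 v) (Icc 0 T) := by
    intro t ht
    have hu' := rlIntegral_rlIntegral (sub_nonneg.2 hν1) hν hu ht
    have hv' := rlIntegral_rlIntegral (sub_nonneg.2 hν1) hν hv ht
    rw [sub_add_cancel] at hu' hv'
    rw [← hu', ← hv', rlIntegral_congr h ht]
  intro t ht
  have hu' := hasDerivWithinAt_rlIntegral le_rfl hu ht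
  have hv' := hasDerivWithinAt_rlIntegral le_rfl hv ht
  rw [zero_add, rlIntegral_zero_order] at hu' hv'
  exact (uniqueDiffOn_Icc hT t ht).eq_deriv _ hu' (hv'.congr_of_mem h1 ht)

theorem continuousOn_caputoDeriv {T γ : ℝ} (hT : 0 < T) {u : ℝ → ℝ}
    (h : HasContCaputoDeriv T γ u) : ContinuousOn (caputoDeriv T γ u) (Icc 0 T) :=
  h.2.continuousOn_iteratedDerivWithin le_rfl (uniqueDiffOn_Icc hT)

/-- A function with a continuous Caputo derivative is recovered from it by `I^γ`. -/
theorem taylorRemainder_eq_rlIntegral_caputoDeriv {T γ : ℝ} (hT : 0 < T) (hγ : 0 < γ)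
    {u : ℝ → ℝ} (h : HasContCaputoDeriv T γ u) :
    EqOn (taylorRemainder T ⌈γ⌉₊ u) (rlIntegral γ (caputoDeriv T γ u)) (Icc 0 T) := by
  have hyc := continuousOn_caputoDeriv hT h
  obtain ⟨m, hm⟩ : ∃ m, ⌈γ⌉₊ = m + 1 := Nat.exists_eq_succ_of_ne_zero (Nat.ceil_pos.2 hγ).ne'
  have hn : 0 ≤ (⌈γ⌉₊ : ℝ) - γ := sub_nonneg.2 (Nat.le_ceil γ)
  have hn1 : (⌈γ⌉₊ : ℝ) - γ ≤ 1 := by linarith [Nat.ceil_lt_add_one hγ.le]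
  have hu : ContDiffOn ℝ m u (Icc 0 T) := by simpa [hm] using h.1
  have hud := uniqueDiffOn_Icc hT
  have h0 : (0 : ℝ) ∈ Icc 0 T := ⟨le_rfl, hT.le⟩
  set z₀ : ℝ := iteratedDerivWithin m u (Icc 0 T) 0 with hz₀
  set z : ℝ → ℝ := fun s => iteratedDerivWithin m u (Icc 0 T) s - z₀ * 1 with hz
  have hic : ContinuousOn (iteratedDerivWithin m u (Icc 0 T)) (Icc 0 T) :=
    hu.continuousOn_iteratedDerivWithin le_rfl hud
  have hzc : ContinuousOn z (Icc 0 T) := hic.sub continuousOn_const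
  -- Here `m = n - 1` is all the smoothness available. The last Taylor term `z₀ I^m 1` is absorbed
  -- into the remainder `I^m u^{(m)}`, so that `z` vanishes at 0.
  have hw : EqOn (taylorRemainder T ⌈γ⌉₊ u) (rlIntegral m z) (Icc 0 T) := by
    intro t ht
    rw [hz, rlIntegral_sub m.cast_nonneg hic continuousOn_const ht, rlIntegral_const_mul,
      taylorRemainder_eq, hm, Finset.sum_range_succ]
    have := taylor_rlIntegral hT m hu t ht
    linarith
  set κ : ℝ := (⌈γ⌉₊ : ℝ) - γ with hκ
  have hWz : EqOn (rlIntegral κ (taylorRemainder T ⌈γ⌉₊ u)) (rlIntegral (m + κ) z)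
      (Icc 0 T) := by
    intro t ht
    rw [rlIntegral_congr hw ht, rlIntegral_rlIntegral hn m.cast_nonneg hzc ht, add_comm]
  -- At 0 the `k`-th derivative is `I^{m-k+κ} z (0)`. It vanishes because the order is positive or,
  -- when `k = m` and `κ = 0`, because `z(0) = 0`. Taylor's formula of order `n` therefore has no
  -- polynomial part.
  have hvan : ∀ k ∈ Finset.range ⌈γ⌉₊, iteratedDerivWithin k
      (rlIntegral κ (taylorRemainder T ⌈γ⌉₊ u)) (Icc 0 T) 0 = 0 := by
    intro k hk
    rw [Finset.mem_range, hm] at hk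
    rw [iteratedDerivWithin_congr hWz h0,
      iteratedDerivWithin_rlIntegral hT hn hzc (Nat.lt_succ_iff.1 hk) h0]
    rcases (add_nonneg (Nat.cast_nonneg (m - k)) hn).eq_or_lt with h' | h'
    · rw [← h', rlIntegral_zero_order]
      simp [hz, hz₀]
    · exact rlIntegral_apply_zero h' z
  have hWy : EqOn (rlIntegral κ (taylorRemainder T ⌈γ⌉₊ u))
      (rlIntegral ⌈γ⌉₊ (caputoDeriv T γ u)) (Icc 0 T) := by
    intro t ht
    rw [taylor_rlIntegral hT ⌈γ⌉₊ h.2 t ht, Finset.sum_eq_zero fun k hk => by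
      rw [hvan k hk, zero_mul], zero_add]
    rfl
  -- Both the remainder and `I^γ` of the Caputo derivative are sent by `I^κ` to the same function,
  -- and `I^κ` is injective since `κ ≤ 1`.
  refine eqOn_of_rlIntegral_eqOn hT hn hn1
    ((continuousOn_rlIntegral m.cast_nonneg hzc).congr hw) (continuousOn_rlIntegral hγ.le hyc) ?_
  intro t ht
  rw [hWy ht, rlIntegral_rlIntegral hn hγ.le hyc ht, hκ, sub_add_cancel]

/-! ### Reduction of the boundary value problem to a fixed-point equation -/

namespace FracBVP

/-- The functions `u`, `𝔇^{β₁} u`, `𝔇^{β₂} u` for `u = d₀ + d₁ t + d₂ t² / 2 + I^α y`. -/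
def profile (P : FracBVP) (d : Fin 3 → ℝ) (y : ℝ → ℝ) : Fin 3 → ℝ → ℝ :=
  ![fun t => d 0 + d 1 * rlIntegral 1 (fun _ => 1) t + d 2 * rlIntegral 2 (fun _ => 1) t
      + rlIntegral P.α y t,
    fun t => d 1 * rlIntegral (1 - P.β₁) (fun _ => 1) t
      + d 2 * rlIntegral (2 - P.β₁) (fun _ => 1) t + rlIntegral (P.α - P.β₁) y t,
    fun t => d 2 * rlIntegral (2 - P.β₂) (fun _ => 1) t + rlIntegral (P.α - P.β₂) y t]

/-- The right-hand side of the equation along the triple `U`. -/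
def rhs (P : FracBVP) (U : Fin 3 → ℝ → ℝ) (s : ℝ) : ℝ := P.f s (U 0 s) (U 1 s) (U 2 s)

/-- The boundary data left after moving the fractional integrals of `y` to the right. -/
def bdryData (P : FracBVP) (u y : ℝ → ℝ) : Fin 3 → ℝ :=
  ![P.lam 0 * (∫ s in (0 : ℝ)..P.T, P.g 0 s (u s)) - P.b 0 * rlIntegral P.α y P.T,
    P.lam 1 * (∫ s in (0 : ℝ)..P.T, P.g 1 s (u s))
      - (P.a 1 * rlIntegral (P.α - P.β₁) y P.η + P.b 1 * rlIntegral (P.α - P.β₁) y P.T),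
    P.lam 2 * (∫ s in (0 : ℝ)..P.T, P.g 2 s (u s))
      - (P.a 2 * rlIntegral (P.α - P.β₂) y P.η + P.b 2 * rlIntegral (P.α - P.β₂) y P.T)]

/-- The slope `u'(0)` determined by the boundary data. -/
def slope (P : FracBVP) (G : Fin 3 → ℝ) : ℝ := P.nu * (G 1 - P.mu 2 / P.mu 1 * G 2)

/-- The Taylor coefficients `u(0)`, `u'(0)`, `u''(0)` determined by the boundary data. -/
def coef (P : FracBVP) (G : Fin 3 → ℝ) : Fin 3 → ℝ :=
  ![(G 0 - P.b 0 * (P.slope G * P.T + P.mu 2 * G 2 * P.T ^ 2)) / (P.a 0 + P.b 0),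
    P.slope G, 2 * P.mu 2 * G 2]

/-- The fixed-point operator of the boundary value problem. -/
def op (P : FracBVP) (U : Fin 3 → ℝ → ℝ) : Fin 3 → ℝ → ℝ :=
  P.profile (P.coef (P.bdryData (U 0) (P.rhs U))) (P.rhs U)

theorem continuousOn_profile {P : FracBVP} (hα : 2 < P.α) (hβ₁ : P.β₁ ≤ 1) (hβ₂ : P.β₂ ≤ 2)
    (d : Fin 3 → ℝ) {y : ℝ → ℝ} (hy : ContinuousOn y (Icc 0 P.T)) (i : Fin 3) :
    ContinuousOn (P.profile d y i) (Icc 0 P.T) := by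
  have h1 : ∀ ν : ℝ, 0 ≤ ν → ContinuousOn (rlIntegral ν fun _ => 1) (Icc 0 P.T) :=
    fun ν hν => continuousOn_rlIntegral hν continuousOn_const
  have h2 : ∀ ν : ℝ, 0 ≤ ν → ContinuousOn (rlIntegral ν y) (Icc 0 P.T) :=
    fun ν hν => continuousOn_rlIntegral hν hy
  fin_cases i
  · exact ((continuousOn_const.add ((h1 1 (by linarith)).const_mul _)).add
      ((h1 2 (by linarith)).const_mul _)).add (h2 _ (by linarith))
  · exact (((h1 _ (by linarith)).const_mul _).add ((h1 _ (by linarith)).const_mul _)).add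
      (h2 _ (by linarith))
  · exact ((h1 _ (by linarith)).const_mul _).add (h2 _ (by linarith))

/-- As `α > 2`, the term `I^α y` is `C²` and vanishes at 0 with its first two derivatives, so `d`
consists of the Taylor data of `u`. -/
theorem contDiffOn_two_of_eq_profile {P : FracBVP} (hT : 0 < P.T) (hα : 2 < P.α)
    {d : Fin 3 → ℝ} {u y : ℝ → ℝ} (hy : ContinuousOn y (Icc 0 P.T))
    (hu : EqOn u (P.profile d y 0) (Icc 0 P.T)) :
    ContDiffOn ℝ 2 u (Icc 0 P.T) ∧ u 0 = d 0 ∧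
      iteratedDerivWithin 1 u (Icc 0 P.T) 0 = d 1 ∧
      iteratedDerivWithin 2 u (Icc 0 P.T) 0 = d 2 := by
  let F : ℕ → ℝ → ℝ
    | 0 => P.profile d y 0
    | 1 => fun t => d 1 + d 2 * rlIntegral 1 (fun _ => 1) t + rlIntegral (P.α - 1) y t
    | _ => fun t => d 2 + rlIntegral (P.α - 2) y t
  have h0 : (0 : ℝ) ∈ Icc 0 P.T := ⟨le_rfl, hT.le⟩
  have hF : ∀ k < 2, ∀ t ∈ Icc 0 P.T, HasDerivWithinAt (F k) (F (k + 1) t) (Icc 0 P.T) t := by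
    intro k hk t ht
    have hJ1 := hasDerivWithinAt_rlIntegral le_rfl (u := fun _ => 1) continuousOn_const ht
    have hJ2 := hasDerivWithinAt_rlIntegral zero_le_one (u := fun _ => 1) continuousOn_const ht
    rw [zero_add, rlIntegral_zero_order] at hJ1
    rw [one_add_one_eq_two] at hJ2
    interval_cases k
    · have hy1 := hasDerivWithinAt_rlIntegral (show 0 ≤ P.α - 1 by linarith) hy ht
      rw [sub_add_cancel] at hy1
      have := (((hJ1.const_mul (d 1)).const_add (d 0)).add (hJ2.const_mul (d 2))).add hy1
      rw [mul_one] at this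
      exact this
    · have hy2 := hasDerivWithinAt_rlIntegral (show 0 ≤ P.α - 2 by linarith) hy ht
      rw [show P.α - 2 + 1 = P.α - 1 by ring] at hy2
      have := ((hJ1.const_mul (d 2)).const_add (d 1)).add hy2
      rw [mul_one] at this
      exact this
  have hF2 : ContinuousOn (F 2) (Icc 0 P.T) :=
    continuousOn_const.add (continuousOn_rlIntegral (by linarith) hy)
  have hd := iteratedDerivWithin_eq_of_chain hT hF
  refine ⟨(contDiffOn_of_chain hT hF hF2).congr hu, ?_, ?_, ?_⟩
  · rw [hu h0]
    simp [profile, rlIntegral_apply_zero, show 0 < P.α by linarith]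
  · rw [iteratedDerivWithin_congr hu h0]
    refine (hd 1 one_le_two h0).trans ?_
    simp [F, rlIntegral_apply_zero, show 1 < P.α by linarith]
  · rw [iteratedDerivWithin_congr hu h0]
    refine (hd 2 le_rfl h0).trans ?_
    simp [F, rlIntegral_apply_zero, hα]

/-- The Taylor remainder of order `⌈γ⌉` keeps only the terms `d_k I^k 1` with `k ≥ ⌈γ⌉` and `I^α y`.
Each is `I^γ` of a term of order lower by `γ`, by the semigroup law. -/
theorem caputo_of_eq_profile {P : FracBVP} (hT : 0 < P.T) (hα : 2 < P.α ∧ P.α ≤ 3)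
    (hβ₁ : 0 < P.β₁ ∧ P.β₁ ≤ 1) (hβ₂ : 1 < P.β₂ ∧ P.β₂ ≤ 2)
    {d : Fin 3 → ℝ} {u y : ℝ → ℝ} (hy : ContinuousOn y (Icc 0 P.T))
    (hu : EqOn u (P.profile d y 0) (Icc 0 P.T)) :
    (HasContCaputoDeriv P.T P.β₁ u ∧
      EqOn (caputoDeriv P.T P.β₁ u) (P.profile d y 1) (Icc 0 P.T)) ∧
    (HasContCaputoDeriv P.T P.β₂ u ∧
      EqOn (caputoDeriv P.T P.β₂ u) (P.profile d y 2) (Icc 0 P.T)) ∧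
    (HasContCaputoDeriv P.T P.α u ∧ EqOn (caputoDeriv P.T P.α u) y (Icc 0 P.T)) := by
  obtain ⟨hc, hd0, hd1, hd2⟩ := contDiffOn_two_of_eq_profile hT hα.1 hy hu
  have hceil1 : ⌈P.β₁⌉₊ = 1 := (Nat.ceil_eq_iff one_ne_zero).2 (by simpa using hβ₁)
  have hceil2 : ⌈P.β₂⌉₊ = 2 := (Nat.ceil_eq_iff two_ne_zero).2 (by simpa using hβ₂)
  have hceil3 : ⌈P.α⌉₊ = 3 := (Nat.ceil_eq_iff three_ne_zero).2 (by norm_num; exact hα)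
  have hp := fun i => continuousOn_profile hα.1 hβ₁.2 hβ₂.2 d hy i
  have hJ : ∀ ν : ℝ, 0 ≤ ν → ContinuousOn (rlIntegral ν fun _ => 1) (Icc 0 P.T) :=
    fun ν hν => continuousOn_rlIntegral hν continuousOn_const
  have hcJ : ContinuousOn (fun _ : ℝ => (1 : ℝ)) (Icc 0 P.T) := continuousOn_const
  refine ⟨?_, ?_, ?_⟩
  · refine caputo_of_taylorRemainder_eq hT hβ₁.1 (hc.of_le (by rw [hceil1]; norm_num)) (hp 1) ?_
    intro t ht
    rw [hceil1, taylorRemainder_eq]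
    simp only [Finset.sum_range_one, iteratedDerivWithin_zero, Nat.cast_zero,
      rlIntegral_zero_order, mul_one, hd0, hu ht, profile, Matrix.cons_val_zero,
      Matrix.cons_val_one]
    have hs1 : ContinuousOn (fun s => d 1 * rlIntegral (1 - P.β₁) (fun _ => 1) s)
        (Icc 0 P.T) := (hJ _ (by linarith)).const_mul _
    have hs2 : ContinuousOn (fun s => d 2 * rlIntegral (2 - P.β₁) (fun _ => 1) s)
        (Icc 0 P.T) := (hJ _ (by linarith)).const_mul _
    have hs12 : ContinuousOn (fun s => d 1 * rlIntegral (1 - P.β₁) (fun _ => 1) s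
        + d 2 * rlIntegral (2 - P.β₁) (fun _ => 1) s) (Icc 0 P.T) := hs1.add hs2
    rw [rlIntegral_add hβ₁.1.le hs12 (continuousOn_rlIntegral (by linarith) hy) ht,
      rlIntegral_add hβ₁.1.le hs1 hs2 ht, rlIntegral_const_mul, rlIntegral_const_mul,
      rlIntegral_rlIntegral hβ₁.1.le (by linarith) hcJ ht,
      rlIntegral_rlIntegral hβ₁.1.le (by linarith) hcJ ht,
      rlIntegral_rlIntegral hβ₁.1.le (by linarith) hy ht]
    simp only [add_sub_cancel]
    ring
  · refine caputo_of_taylorRemainder_eq hT (by linarith) (hc.of_le (by rw [hceil2]; norm_num))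
      (hp 2) ?_
    intro t ht
    have hβ : 0 ≤ P.β₂ := by linarith
    rw [hceil2, taylorRemainder_eq]
    simp only [Finset.sum_range_succ, Finset.sum_range_zero, iteratedDerivWithin_zero,
      Nat.cast_zero, Nat.cast_one,
      rlIntegral_zero_order, mul_one, hd0, hd1, hu ht, profile, Matrix.cons_val_zero,
      Matrix.cons_val]
    rw [rlIntegral_add hβ ((hJ _ (by linarith)).const_mul _)
        (continuousOn_rlIntegral (by linarith) hy) ht, rlIntegral_const_mul,
      rlIntegral_rlIntegral hβ (by linarith) hcJ ht,
      rlIntegral_rlIntegral hβ (by linarith) hy ht]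
    simp only [add_sub_cancel]
    ring
  · refine caputo_of_taylorRemainder_eq hT (by linarith) (hc.of_le (by rw [hceil3]; norm_num))
      hy ?_
    intro t ht
    rw [hceil3, taylorRemainder_eq]
    simp only [Finset.sum_range_succ, Finset.sum_range_zero, iteratedDerivWithin_zero,
      Nat.cast_zero, Nat.cast_one, Nat.cast_ofNat,
      rlIntegral_zero_order, mul_one, hd0, hd1, hd2, hu ht, profile, Matrix.cons_val_zero]
    ring

theorem eqOn_profile_of_hasContCaputoDeriv {P : FracBVP} (hT : 0 < P.T)
    (hα : 2 < P.α ∧ P.α ≤ 3) {u : ℝ → ℝ} (h : HasContCaputoDeriv P.T P.α u) :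
    ∃ d : Fin 3 → ℝ, EqOn u (P.profile d (caputoDeriv P.T P.α u) 0) (Icc 0 P.T) := by
  have hceil3 : ⌈P.α⌉₊ = 3 := (Nat.ceil_eq_iff three_ne_zero).2 (by norm_num; exact hα)
  refine ⟨fun i => iteratedDerivWithin i u (Icc 0 P.T) 0, fun t ht => ?_⟩
  have := taylorRemainder_eq_rlIntegral_caputoDeriv hT (by linarith) h ht
  rw [hceil3, taylorRemainder_eq] at this
  simp only [Finset.sum_range_succ, Finset.sum_range_zero, Nat.cast_zero, Nat.cast_one,
    Nat.cast_ofNat, rlIntegral_zero_order, mul_one] at this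
  simp only [profile, Matrix.cons_val_zero, Fin.val_zero, Fin.val_one, Fin.val_two]
  linarith

/-- The boundary conditions determine the Taylor coefficients. -/
theorem boundary_iff_eq_coef {P : FracBVP} (hα : 2 < P.α) (hβ₁ : P.β₁ ≤ 1)
    (hβ₂ : P.β₂ ≤ 2)
    (hab0 : P.a 0 + P.b 0 ≠ 0)
    (hab1 : P.a 1 * P.η ^ (1 - P.β₁) + P.b 1 * P.T ^ (1 - P.β₁) ≠ 0)
    (hab2 : P.a 1 * P.η ^ (2 - P.β₁) + P.b 1 * P.T ^ (2 - P.β₁) ≠ 0)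
    (hab3 : P.a 2 * P.η ^ (2 - P.β₂) + P.b 2 * P.T ^ (2 - P.β₂) ≠ 0)
    (d : Fin 3 → ℝ) (u y : ℝ → ℝ) :
    (P.a 0 * P.profile d y 0 0 + P.b 0 * P.profile d y 0 P.T
        = P.lam 0 * ∫ s in (0 : ℝ)..P.T, P.g 0 s (u s)) ∧
    (P.a 1 * P.profile d y 1 P.η + P.b 1 * P.profile d y 1 P.T
        = P.lam 1 * ∫ s in (0 : ℝ)..P.T, P.g 1 s (u s)) ∧
    (P.a 2 * P.profile d y 2 P.η + P.b 2 * P.profile d y 2 P.T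
        = P.lam 2 * ∫ s in (0 : ℝ)..P.T, P.g 2 s (u s)) ↔
    d = P.coef (P.bdryData u y) := by
  set G := P.bdryData u y with hG
  have hΓ1 : 0 < Real.Gamma (2 - P.β₁) := Real.Gamma_pos_of_pos (by linarith)
  have hΓ2 : 0 < Real.Gamma (3 - P.β₁) := Real.Gamma_pos_of_pos (by linarith)
  have hΓ3 : 0 < Real.Gamma (3 - P.β₂) := Real.Gamma_pos_of_pos (by linarith)
  have e1 : P.nu * (P.a 1 * P.η ^ (1 - P.β₁) + P.b 1 * P.T ^ (1 - P.β₁)) =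
      Real.Gamma (2 - P.β₁) := div_mul_cancel₀ _ hab1
  have e2 : 2 * P.mu 1 * (P.a 1 * P.η ^ (2 - P.β₁) + P.b 1 * P.T ^ (2 - P.β₁)) =
      Real.Gamma (3 - P.β₁) := by
    simp only [mu, β, Matrix.cons_val_one, Matrix.cons_val_zero]
    field_simp
  have e3 : 2 * P.mu 2 * (P.a 2 * P.η ^ (2 - P.β₂) + P.b 2 * P.T ^ (2 - P.β₂)) =
      Real.Gamma (3 - P.β₂) := by
    simp only [mu, β, Matrix.cons_val]
    field_simp
  have hnu : P.nu ≠ 0 := fun h => by rw [h, zero_mul] at e1; exact hΓ1.ne e1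
  have hmu1 : P.mu 1 ≠ 0 := fun h => by rw [h, mul_zero, zero_mul] at e2; exact hΓ2.ne e2
  have hmu2 : P.mu 2 ≠ 0 := fun h => by rw [h, mul_zero, zero_mul] at e3; exact hΓ3.ne e3
  -- With the integrals of `y` on the right, the system is triangular in `d 0, d 1, d 2`, with
  -- diagonal entries `a₀ + b₀`, `1/ν`, `1/(2 μ₂)`; `1/(2 μ₁)` is the coefficient of `d 2` in the
  -- second equation. Back substitution gives `coef`.
  have b0 : (P.a 0 * P.profile d y 0 0 + P.b 0 * P.profile d y 0 P.T
        = P.lam 0 * ∫ s in (0 : ℝ)..P.T, P.g 0 s (u s)) ↔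
      (P.a 0 + P.b 0) * d 0 + P.b 0 * (d 1 * P.T + d 2 / 2 * P.T ^ 2) = G 0 := by
    have hJ1 := rlIntegral_natCast_one 1 P.T
    have hJ2 := rlIntegral_natCast_one 2 P.T
    norm_num at hJ1 hJ2
    simp only [profile, hG, bdryData, Matrix.cons_val_zero, hJ1, hJ2,
      rlIntegral_apply_zero one_pos, rlIntegral_apply_zero two_pos,
      rlIntegral_apply_zero (show 0 < P.α by linarith)]
    constructor <;> intro h <;> linear_combination h
  have b1 : (P.a 1 * P.profile d y 1 P.η + P.b 1 * P.profile d y 1 P.T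
        = P.lam 1 * ∫ s in (0 : ℝ)..P.T, P.g 1 s (u s)) ↔
      d 1 / P.nu + d 2 / (2 * P.mu 1) = G 1 := by
    have h1 : 1 / P.nu = (P.a 1 * P.η ^ (1 - P.β₁) + P.b 1 * P.T ^ (1 - P.β₁)) /
        Real.Gamma (2 - P.β₁) := by rw [← e1]; field_simp
    have h2 : 1 / (2 * P.mu 1) = (P.a 1 * P.η ^ (2 - P.β₁) + P.b 1 * P.T ^ (2 - P.β₁)) /
        Real.Gamma (3 - P.β₁) := by rw [← e2]; field_simp
    rw [div_eq_mul_one_div, h1, div_eq_mul_one_div (d 2), h2]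
    simp only [profile, hG, bdryData, Matrix.cons_val_one, Matrix.cons_val_zero,
      rlIntegral_one (show 0 ≤ 1 - P.β₁ by linarith), rlIntegral_one (show 0 ≤ 2 - P.β₁ by linarith),
      show 1 - P.β₁ + 1 = 2 - P.β₁ by ring, show 2 - P.β₁ + 1 = 3 - P.β₁ by ring]
    constructor <;> intro h <;> linear_combination h
  have b2 : (P.a 2 * P.profile d y 2 P.η + P.b 2 * P.profile d y 2 P.T
        = P.lam 2 * ∫ s in (0 : ℝ)..P.T, P.g 2 s (u s)) ↔ d 2 / (2 * P.mu 2) = G 2 := by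
    have h2 : 1 / (2 * P.mu 2) = (P.a 2 * P.η ^ (2 - P.β₂) + P.b 2 * P.T ^ (2 - P.β₂)) /
        Real.Gamma (3 - P.β₂) := by rw [← e3]; field_simp
    rw [div_eq_mul_one_div, h2]
    simp only [profile, hG, bdryData, Matrix.cons_val,
      rlIntegral_one (show 0 ≤ 2 - P.β₂ by linarith), show 2 - P.β₂ + 1 = 3 - P.β₂ by ring]
    constructor <;> intro h <;> linear_combination h
  rw [b0, b1, b2]
  constructor
  · rintro ⟨h0, h1, h2⟩
    have h2' : d 2 = 2 * P.mu 2 * G 2 := by rw [← h2]; field_simp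
    have h1' : d 1 = P.slope G := by
      rw [slope, ← h1, h2']
      field_simp
      ring
    funext i
    fin_cases i
    · simp only [coef, Fin.zero_eta, Matrix.cons_val_zero]
      rw [eq_div_iff hab0, ← h1', ← h0, h2']
      ring
    · exact h1'
    · exact h2'
  · intro h
    have h0 : d 0 = (G 0 - P.b 0 * (P.slope G * P.T + P.mu 2 * G 2 * P.T ^ 2)) /
      (P.a 0 + P.b 0) := by rw [h]; rfl
    have h1 : d 1 = P.slope G := by rw [h]; rfl
    have h2 : d 2 = 2 * P.mu 2 * G 2 := by rw [h]; rfl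
    refine ⟨?_, ?_, ?_⟩
    · rw [h0, h1, h2, mul_div_cancel₀ _ hab0]
      ring
    · rw [h1, h2, slope]
      field_simp
      ring
    · rw [h2]
      field_simp

theorem continuousOn_rhs {P : FracBVP}
    (hf : ContinuousOn (fun p : ℝ × ℝ × ℝ × ℝ => P.f p.1 p.2.1 p.2.2.1 p.2.2.2)
      (Icc 0 P.T ×ˢ univ))
    {U : Fin 3 → ℝ → ℝ} (hU : ∀ i, ContinuousOn (U i) (Icc 0 P.T)) :
    ContinuousOn (P.rhs U) (Icc 0 P.T) :=
  hf.comp (f := fun s => (s, U 0 s, U 1 s, U 2 s))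
    (continuousOn_id.prodMk ((hU 0).prodMk ((hU 1).prodMk (hU 2))))
    fun _ hs => ⟨hs, mem_univ _⟩

theorem profile_congr {P : FracBVP} {d : Fin 3 → ℝ} {y z : ℝ → ℝ}
    (h : EqOn y z (Icc 0 P.T)) (i : Fin 3) :
    EqOn (P.profile d y i) (P.profile d z i) (Icc 0 P.T) := by
  intro t ht
  have hI : ∀ ν, rlIntegral ν y t = rlIntegral ν z t := fun ν => rlIntegral_congr h ht
  fin_cases i <;> simp [profile, hI]

/-- Solutions of the boundary value problem are fixed points of `op`. -/
theorem IsSolution.eqOn_op {P : FracBVP} {u : ℝ → ℝ} (hu : P.IsSolution u)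
    (hα : 2 < P.α ∧ P.α ≤ 3) (hβ₁ : 0 < P.β₁ ∧ P.β₁ ≤ 1) (hβ₂ : 1 < P.β₂ ∧ P.β₂ ≤ 2)
    (hη : 0 < P.η ∧ P.η < P.T) (hab0 : P.a 0 + P.b 0 ≠ 0)
    (hab1 : P.a 1 * P.η ^ (1 - P.β₁) + P.b 1 * P.T ^ (1 - P.β₁) ≠ 0)
    (hab2 : P.a 1 * P.η ^ (2 - P.β₁) + P.b 1 * P.T ^ (2 - P.β₁) ≠ 0)
    (hab3 : P.a 2 * P.η ^ (2 - P.β₂) + P.b 2 * P.T ^ (2 - P.β₂) ≠ 0) (i : Fin 3) :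
    EqOn (![u, caputoDeriv P.T P.β₁ u, caputoDeriv P.T P.β₂ u] i)
      (P.op ![u, caputoDeriv P.T P.β₁ u, caputoDeriv P.T P.β₂ u] i) (Icc 0 P.T) := by
  have hT : 0 < P.T := hη.1.trans hη.2
  set U : Fin 3 → ℝ → ℝ := ![u, caputoDeriv P.T P.β₁ u, caputoDeriv P.T P.β₂ u] with hU
  have hy : EqOn (caputoDeriv P.T P.α u) (P.rhs U) (Icc 0 P.T) := fun t ht => hu.eqn t ht
  have hyc : ContinuousOn (P.rhs U) (Icc 0 P.T) :=
    (continuousOn_caputoDeriv hT hu.diff).congr hy.symm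
  obtain ⟨d, hd⟩ := eqOn_profile_of_hasContCaputoDeriv hT hα hu.diff
  have hd' : EqOn u (P.profile d (P.rhs U) 0) (Icc 0 P.T) := hd.trans (profile_congr hy 0)
  obtain ⟨⟨-, hD1⟩, ⟨-, hD2⟩, -⟩ := caputo_of_eq_profile hT hα hβ₁ hβ₂ hyc hd'
  have h0m : (0 : ℝ) ∈ Icc 0 P.T := ⟨le_rfl, hT.le⟩
  have hTm : P.T ∈ Icc 0 P.T := ⟨hT.le, le_rfl⟩
  have hηm : P.η ∈ Icc 0 P.T := ⟨hη.1.le, hη.2.le⟩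
  have hcoef := (boundary_iff_eq_coef hα.1 hβ₁.2 hβ₂.2 hab0 hab1 hab2 hab3 d u
    (P.rhs U)).1 ⟨by rw [← hd' h0m, ← hd' hTm]; exact hu.bc0,
      by rw [← hD1 hηm, ← hD1 hTm]; exact hu.bc1, by rw [← hD2 hηm, ← hD2 hTm]; exact hu.bc2⟩
  have hop : P.op U = P.profile d (P.rhs U) := by rw [hcoef]; rfl
  rw [hop]
  fin_cases i
  · exact hd'
  · exact hD1
  · exact hD2

/-- Continuous fixed points of `op` give solutions of the boundary value problem. -/
theorem isSolution_of_eqOn_op {P : FracBVP} {U : Fin 3 → ℝ → ℝ}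
    (hα : 2 < P.α ∧ P.α ≤ 3) (hβ₁ : 0 < P.β₁ ∧ P.β₁ ≤ 1) (hβ₂ : 1 < P.β₂ ∧ P.β₂ ≤ 2)
    (hη : 0 < P.η ∧ P.η < P.T) (hab0 : P.a 0 + P.b 0 ≠ 0)
    (hab1 : P.a 1 * P.η ^ (1 - P.β₁) + P.b 1 * P.T ^ (1 - P.β₁) ≠ 0)
    (hab2 : P.a 1 * P.η ^ (2 - P.β₁) + P.b 1 * P.T ^ (2 - P.β₁) ≠ 0)
    (hab3 : P.a 2 * P.η ^ (2 - P.β₂) + P.b 2 * P.T ^ (2 - P.β₂) ≠ 0)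
    (hf : ContinuousOn (fun p : ℝ × ℝ × ℝ × ℝ => P.f p.1 p.2.1 p.2.2.1 p.2.2.2)
      (Icc 0 P.T ×ˢ univ))
    (hUc : ∀ i, ContinuousOn (U i) (Icc 0 P.T))
    (hU : ∀ i, EqOn (U i) (P.op U i) (Icc 0 P.T)) : P.IsSolution (U 0) := by
  have hT : 0 < P.T := hη.1.trans hη.2
  have h0m : (0 : ℝ) ∈ Icc 0 P.T := ⟨le_rfl, hT.le⟩
  have hTm : P.T ∈ Icc 0 P.T := ⟨hT.le, le_rfl⟩
  have hηm : P.η ∈ Icc 0 P.T := ⟨hη.1.le, hη.2.le⟩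
  -- The fixed-point equation for `U 0` alone gives the Caputo derivatives of `U 0` as components 1
  -- and 2 of `op U`; the other two equations identify these with `U 1` and `U 2`.
  obtain ⟨⟨hC1, hD1⟩, ⟨hC2, hD2⟩, hC3, hD3⟩ :=
    caputo_of_eq_profile hT hα hβ₁ hβ₂ (continuousOn_rhs hf hUc) (hU 0)
  obtain ⟨hb0, hb1, hb2⟩ := (boundary_iff_eq_coef hα.1 hβ₁.2 hβ₂.2 hab0 hab1 hab2 hab3
    (P.coef (P.bdryData (U 0) (P.rhs U))) (U 0) (P.rhs U)).2 rfl
  refine ⟨⟨hUc 0, hC1, hC2⟩, hC3, fun t ht => ?_, ?_, ?_, ?_⟩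
  · rw [hD3 ht, hD1 ht, hD2 ht, rhs, hU 1 ht, hU 2 ht]
    rfl
  · rw [hU 0 h0m, hU 0 hTm]
    exact hb0
  · rw [hD1 hηm, hD1 hTm]
    exact hb1
  · rw [hD2 hηm, hD2 hTm]
    exact hb2

end FracBVP

/-! ### Hölder estimate for fractional integrals -/

/-- The exponent `1/(1-τ)` is conjugate to `1/τ`. It turns the kernel into `(t - s)^(κ - 1)` with `κ
= (ν - τ)/(1 - τ)`, integrable because `τ < ν`. -/
theorem memLp_sub_rpow {τ ν t : ℝ} (hτ1 : τ < 1) (hν : τ < ν) :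
    MemLp (fun s => (t - s) ^ (ν - 1)) (ENNReal.ofReal (1 / (1 - τ)))
      (volume.restrict (Ioc 0 t)) ∧
    (∫ s in Ioc 0 t, ((t - s) ^ (ν - 1)) ^ (1 / (1 - τ))) =
      if 0 ≤ t then t ^ ((ν - τ) / (1 - τ)) / ((ν - τ) / (1 - τ)) else 0 := by
  have h1 : 0 < 1 - τ := sub_pos.2 hτ1
  have hκ : 0 < (ν - τ) / (1 - τ) := div_pos (sub_pos.2 hν) h1
  have hpow : ∀ s ∈ Ioc 0 t, ((t - s) ^ (ν - 1)) ^ (1 / (1 - τ)) =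
      (t - s) ^ ((ν - τ) / (1 - τ) - 1) := by
    intro s hs
    rw [← Real.rpow_mul (by linarith [hs.2])]
    congr 1
    field_simp
    ring
  rcases lt_or_ge t 0 with ht | ht
  · simp [Ioc_eq_empty (not_lt.2 ht.le), ht.not_ge]
  have hint := (intervalIntegrable_sub_rpow hκ t)
  constructor
  · have hm : AEStronglyMeasurable (fun s : ℝ => (t - s) ^ (ν - 1))
        (volume.restrict (Ioc 0 t)) := by
      apply Measurable.aestronglyMeasurable
      fun_prop
    have hp0 : ENNReal.ofReal (1 / (1 - τ)) ≠ 0 := by simpa using hτ1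
    rw [← integrable_norm_rpow_iff hm hp0 ENNReal.ofReal_ne_top,
      ENNReal.toReal_ofReal (by positivity)]
    refine (integrable_congr ?_).2 hint.1
    filter_upwards [ae_restrict_mem measurableSet_Ioc] with s hs
    rw [Real.norm_of_nonneg (Real.rpow_nonneg (by linarith [hs.2]) _), hpow s hs]
  · rw [setIntegral_congr_fun measurableSet_Ioc hpow, ← intervalIntegral.integral_of_le ht,
      integral_sub_rpow hκ, if_pos ht]

/-- Hölder bound for `I^ν y` when `y` is dominated by an `L^{1/τ}` function. -/
theorem abs_rlIntegral_le_holder {T τ ν D : ℝ} (hτ : 0 < τ) (hτ1 : τ < 1) (hν : τ < ν)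
    {l y : ℝ → ℝ} (hl : MemLp l (ENNReal.ofReal (1 / τ)) (volume.restrict (Icc 0 T)))
    (hl0 : ∀ s ∈ Icc 0 T, 0 ≤ l s) (hD : 0 ≤ D) (h : ∀ s ∈ Icc 0 T, |y s| ≤ l s * D)
    {t : ℝ} (ht : t ∈ Icc 0 T) :
    |rlIntegral ν y t| ≤ t ^ (ν - τ) / Real.Gamma ν * ((1 - τ) / (ν - τ)) ^ (1 - τ) *
      (eLpNorm l (ENNReal.ofReal (1 / τ)) (volume.restrict (Icc 0 T))).toReal * D := by
  have hν0 : 0 < ν := hτ.trans hν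
  have h1 : 0 < 1 - τ := sub_pos.2 hτ1
  have hντ : 0 < ν - τ := sub_pos.2 hν
  have hΓ := Real.Gamma_pos_of_pos hν0
  have hsub : Ioc 0 t ⊆ Icc 0 T := fun s hs => ⟨hs.1.le, hs.2.trans ht.2⟩
  have hmle : volume.restrict (Ioc 0 t) ≤ volume.restrict (Icc 0 T) :=
    Measure.restrict_mono hsub le_rfl
  have hl' : MemLp l (ENNReal.ofReal (1 / τ)) (volume.restrict (Ioc 0 t)) := hl.mono_measure hmle
  obtain ⟨hk, hkint⟩ := memLp_sub_rpow (t := t) hτ1 hν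
  have hpq : (1 / (1 - τ)).HolderConjugate (1 / τ) := by
    rw [Real.holderConjugate_iff]
    refine ⟨by rw [lt_div_iff₀ h1]; linarith, by simp⟩
  have hk0 : 0 ≤ᵐ[volume.restrict (Ioc 0 t)] fun s => (t - s) ^ (ν - 1) := by
    filter_upwards [ae_restrict_mem measurableSet_Ioc] with s hs
    exact Real.rpow_nonneg (by linarith [hs.2]) _
  have hl0' : 0 ≤ᵐ[volume.restrict (Ioc 0 t)] l := by
    filter_upwards [ae_restrict_mem measurableSet_Ioc] with s hs
    exact hl0 s (hsub hs)
  have hH := integral_mul_le_Lp_mul_Lq_of_nonneg hpq hk0 hl0' hk hl'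
  have hlnorm : (∫ s in Ioc 0 t, l s ^ (1 / τ)) ^ (1 / (1 / τ)) ≤
      (eLpNorm l (ENNReal.ofReal (1 / τ)) (volume.restrict (Icc 0 T))).toReal := by
    have he := hl'.eLpNorm_eq_integral_rpow_norm (by simpa using hτ) ENNReal.ofReal_ne_top
    rw [ENNReal.toReal_ofReal (by positivity)] at he
    have hc : ∫ s in Ioc 0 t, ‖l s‖ ^ (1 / τ) = ∫ s in Ioc 0 t, l s ^ (1 / τ) :=
      setIntegral_congr_fun measurableSet_Ioc fun s hs => by
        simp only [Real.norm_of_nonneg (hl0 s (hsub hs))]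
    rw [hc] at he
    have hn : 0 ≤ ∫ s in Ioc 0 t, l s ^ (1 / τ) :=
      setIntegral_nonneg measurableSet_Ioc fun s hs => Real.rpow_nonneg (hl0 s (hsub hs)) _
    rw [one_div (1 / τ), ← ENNReal.toReal_ofReal (Real.rpow_nonneg hn (1 / τ)⁻¹), ← he]
    exact ENNReal.toReal_mono hl.eLpNorm_ne_top (eLpNorm_mono_measure l hmle)
  -- The power `1 - τ` of `t^κ / κ`; this is the origin of `holderFactor`.
  have hkval : (∫ s in Ioc 0 t, ((t - s) ^ (ν - 1)) ^ (1 / (1 - τ))) ^ (1 / (1 / (1 - τ))) =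
      t ^ (ν - τ) * ((1 - τ) / (ν - τ)) ^ (1 - τ) := by
    rw [hkint, if_pos ht.1, one_div_one_div, div_eq_mul_inv, inv_div,
      Real.mul_rpow (Real.rpow_nonneg ht.1 _) (by positivity), ← Real.rpow_mul ht.1,
      div_mul_cancel₀ _ h1.ne']
  rw [hkval] at hH
  have : ENNReal.HolderTriple (ENNReal.ofReal (1 / (1 - τ))) (ENNReal.ofReal (1 / τ)) 1 := by
    simpa using! hpq.ennrealOfReal
  have hint : Integrable (fun s => (t - s) ^ (ν - 1) * l s) (volume.restrict (Ioc 0 t)) :=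
    hk.integrable_mul hl'
  have hb : |∫ s in (0 : ℝ)..t, (t - s) ^ (ν - 1) * y s| ≤
      (∫ s in Ioc 0 t, (t - s) ^ (ν - 1) * l s) * D := by
    rw [intervalIntegral.integral_of_le ht.1, ← integral_mul_const, ← Real.norm_eq_abs]
    refine norm_integral_le_of_norm_le (hint.mul_const D) ?_
    filter_upwards [ae_restrict_mem measurableSet_Ioc, hk0] with s hs hk0s
    rw [Real.norm_eq_abs, abs_mul, abs_of_nonneg hk0s, mul_assoc]
    exact mul_le_mul_of_nonneg_left (h s (hsub hs)) hk0s
  rw [rlIntegral_of_pos hν0, abs_mul, abs_of_pos (inv_pos.2 hΓ)]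
  have hc0 : 0 ≤ t ^ (ν - τ) * ((1 - τ) / (ν - τ)) ^ (1 - τ) :=
    mul_nonneg (Real.rpow_nonneg ht.1 _) (Real.rpow_nonneg (by positivity) _)
  calc (Real.Gamma ν)⁻¹ * |∫ s in (0 : ℝ)..t, (t - s) ^ (ν - 1) * y s|
      ≤ (Real.Gamma ν)⁻¹ * ((t ^ (ν - τ) * ((1 - τ) / (ν - τ)) ^ (1 - τ) *
          (eLpNorm l (ENNReal.ofReal (1 / τ)) (volume.restrict (Icc 0 T))).toReal) * D) :=
        mul_le_mul_of_nonneg_left (hb.trans (mul_le_mul_of_nonneg_right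
          (hH.trans (mul_le_mul_of_nonneg_left hlnorm hc0)) hD)) (inv_pos.2 hΓ).le
    _ = _ := by ring

/-! ### Lipschitz estimates for the operator -/

namespace FracBVP

theorem abs_integral_sub_le_normLp_one {P : FracBVP} (hT : 0 ≤ P.T) {g : ℝ → ℝ → ℝ} {l : ℝ → ℝ}
    (hg : ContinuousOn (fun p : ℝ × ℝ => g p.1 p.2) (Icc 0 P.T ×ˢ univ))
    (hl0 : ∀ t ∈ Icc 0 P.T, 0 ≤ l t) (hl : MemLp l 1 (volume.restrict (Icc 0 P.T)))
    (hlip : ∀ t ∈ Icc 0 P.T, ∀ u v : ℝ, |g t u - g t v| ≤ l t * |u - v|)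
    {u v : ℝ → ℝ} (hu : ContinuousOn u (Icc 0 P.T)) (hv : ContinuousOn v (Icc 0 P.T))
    {D : ℝ} (h : ∀ s ∈ Icc 0 P.T, |u s - v s| ≤ D) :
    |(∫ s in (0 : ℝ)..P.T, g s (u s)) - ∫ s in (0 : ℝ)..P.T, g s (v s)| ≤
      P.normLp 1 l * D := by
  have hc : ∀ {w : ℝ → ℝ}, ContinuousOn w (Icc 0 P.T) →
      IntervalIntegrable (fun s => g s (w s)) volume 0 P.T := fun {w} hw =>
    (hg.comp (f := fun s => (s, w s)) (continuousOn_id.prodMk hw)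
      fun _ hs => ⟨hs, mem_univ _⟩).intervalIntegrable_of_Icc hT
  have hli : Integrable l (volume.restrict (Icc 0 P.T)) := memLp_one_iff_integrable.1 hl
  have hN : P.normLp 1 l = ∫ s in Icc 0 P.T, l s := by
    rw [normLp, ENNReal.ofReal_one, eLpNorm_one_eq_lintegral_enorm,
      ← integral_norm_eq_lintegral_enorm hl.1]
    exact setIntegral_congr_fun measurableSet_Icc fun s hs => Real.norm_of_nonneg (hl0 s hs)
  rw [← intervalIntegral.integral_sub (hc hu) (hc hv), hN, ← integral_mul_const,
    intervalIntegral.integral_of_le hT, ← integral_Icc_eq_integral_Ioc, ← Real.norm_eq_abs]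
  refine norm_integral_le_of_norm_le (hli.mul_const D) ?_
  filter_upwards [ae_restrict_mem measurableSet_Icc] with s hs
  exact (hlip s hs _ _).trans (mul_le_mul_of_nonneg_left (h s hs) (hl0 s hs))

theorem abs_slope_sub_le {P : FracBVP} {G H e : Fin 3 → ℝ} (h : ∀ i, |G i - H i| ≤ e i) :
    |P.slope G - P.slope H| ≤ |P.nu| * (e 1 + |P.mu 2| / |P.mu 1| * e 2) := by
  have e1 : P.slope G - P.slope H =
      P.nu * ((G 1 - H 1) - P.mu 2 / P.mu 1 * (G 2 - H 2)) := by
    simp only [slope]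
    ring
  rw [e1, abs_mul, ← abs_div]
  refine mul_le_mul_of_nonneg_left ((abs_sub _ _).trans (add_le_add (h 1) ?_)) (abs_nonneg _)
  rw [abs_mul]
  exact mul_le_mul_of_nonneg_left (h 2) (abs_nonneg _)

/-- The profile is linear in the pair of boundary data and `y`, so the triangle inequality suffices.
`E₁` controls the change of `u'(0)` and `E₂` that of `u''(0)/2`; collecting the coefficients of each
`e i` produces `rho`, `rhoTilde` and `rhoHat`. -/
theorem abs_profile_sub_le {P : FracBVP} (hT : 0 < P.T) (hβ₁ : P.β₁ ≤ 1) (hβ₂ : P.β₂ ≤ 2)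
    {G H e δ : Fin 3 → ℝ} {y z : ℝ → ℝ} (h : ∀ i, |G i - H i| ≤ e i) {t : ℝ}
    (ht : t ∈ Icc 0 P.T)
    (hδ : ∀ i, |rlIntegral (P.α - P.β i) y t - rlIntegral (P.α - P.β i) z t| ≤ δ i) :
    |P.profile (P.coef G) y 0 t - P.profile (P.coef H) z 0 t| ≤ ∑ i, P.rho i * e i + δ 0 ∧
    |P.profile (P.coef G) y 1 t - P.profile (P.coef H) z 1 t| ≤
      P.rhoTilde 1 * e 1 + P.rhoTilde 2 * e 2 + δ 1 ∧
    |P.profile (P.coef G) y 2 t - P.profile (P.coef H) z 2 t| ≤ P.rhoHat 2 * e 2 + δ 2 := by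
  have hδ0 := hδ 0
  have hδ1 := hδ 1
  have hδ2 := hδ 2
  simp only [β, Matrix.cons_val, sub_zero] at hδ0 hδ1 hδ2
  set E₁ := |P.nu| * (e 1 + |P.mu 2| / |P.mu 1| * e 2) with hE₁
  set E₂ := |P.mu 2| * e 2 with hE₂
  have hd1 : |P.slope G - P.slope H| ≤ E₁ := abs_slope_sub_le h
  have hd2 : |P.mu 2 * G 2 - P.mu 2 * H 2| ≤ E₂ := by
    rw [← mul_sub, abs_mul]
    exact mul_le_mul_of_nonneg_left (h 2) (abs_nonneg _)
  have hE₁0 : 0 ≤ E₁ := (abs_nonneg _).trans hd1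
  have hE₂0 : 0 ≤ E₂ := (abs_nonneg _).trans hd2
  have hJ : ∀ ν : ℝ, 0 ≤ ν → 0 ≤ rlIntegral ν (fun _ => 1) t ∧
      rlIntegral ν (fun _ => 1) t ≤ P.T ^ ν / Real.Gamma (ν + 1) := by
    intro ν hν
    have hΓ : 0 < Real.Gamma (ν + 1) := Real.Gamma_pos_of_pos (by linarith)
    rw [rlIntegral_one hν]
    exact ⟨div_nonneg (Real.rpow_nonneg ht.1 _) hΓ.le,
      div_le_div_of_nonneg_right (Real.rpow_le_rpow ht.1 ht.2 hν) hΓ.le⟩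
  have hterm : ∀ {a E j M : ℝ}, |a| ≤ E → 0 ≤ j → j ≤ M → |a * j| ≤ E * M := by
    intro a E j M ha hj hM
    rw [abs_mul, abs_of_nonneg hj]
    exact mul_le_mul ha hM hj ((abs_nonneg _).trans ha)
  refine ⟨?_, ?_, ?_⟩
  · have hd0 : |(P.coef G 0 - P.coef H 0)| ≤
        (e 0 + |P.b 0| * (E₁ * P.T + E₂ * P.T ^ 2)) / |P.a 0 + P.b 0| := by
      have e1 : P.coef G 0 - P.coef H 0 = ((G 0 - H 0) - P.b 0 *
          ((P.slope G - P.slope H) * P.T + (P.mu 2 * G 2 - P.mu 2 * H 2) * P.T ^ 2)) /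
          (P.a 0 + P.b 0) := by
        simp only [coef, Matrix.cons_val_zero]
        ring
      rw [e1, abs_div]
      refine div_le_div_of_nonneg_right ((abs_sub _ _).trans (add_le_add (h 0) ?_))
        (abs_nonneg _)
      rw [abs_mul]
      exact mul_le_mul_of_nonneg_left ((abs_add_le _ _).trans (add_le_add
        (hterm hd1 hT.le le_rfl) (hterm hd2 (by positivity) le_rfl))) (abs_nonneg _)
    have hJ1 := hJ 1 zero_le_one
    have hJ2 := hJ 2 zero_le_two
    rw [Real.rpow_one, show Real.Gamma (1 + 1) = 1 by norm_num [Real.Gamma_two], div_one] at hJ1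
    rw [Real.rpow_two, show Real.Gamma (2 + 1) = 2 by
      rw [Real.Gamma_add_one two_ne_zero, Real.Gamma_two, mul_one]] at hJ2
    have e2 : P.profile (P.coef G) y 0 t - P.profile (P.coef H) z 0 t =
        (P.coef G 0 - P.coef H 0) + (P.slope G - P.slope H) * rlIntegral 1 (fun _ => 1) t
        + (P.mu 2 * G 2 - P.mu 2 * H 2) * (2 * rlIntegral 2 (fun _ => 1) t)
        + (rlIntegral P.α y t - rlIntegral P.α z t) := by
      simp only [profile, coef, Matrix.cons_val]
      ring
    have e3 : ∑ i, P.rho i * e i = (e 0 + |P.b 0| * (E₁ * P.T + E₂ * P.T ^ 2)) / |P.a 0 + P.b 0|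
        + E₁ * P.T + E₂ * P.T ^ 2 := by
      simp only [Fin.sum_univ_three, rho, hE₁, hE₂, Matrix.cons_val]
      ring
    rw [e2, e3]
    exact (abs_add_le _ _).trans (add_le_add ((abs_add_le _ _).trans (add_le_add
      ((abs_add_le _ _).trans (add_le_add hd0 (hterm hd1 hJ1.1 hJ1.2)))
      (hterm hd2 (by linarith [hJ2.1]) (by linarith [hJ2.2])))) hδ0)
  · have hJ1 := hJ (1 - P.β₁) (by linarith)
    have hJ2 := hJ (2 - P.β₁) (by linarith)
    rw [show 1 - P.β₁ + 1 = 2 - P.β₁ by ring] at hJ1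
    rw [show 2 - P.β₁ + 1 = 3 - P.β₁ by ring] at hJ2
    have e2 : P.profile (P.coef G) y 1 t - P.profile (P.coef H) z 1 t =
        (P.slope G - P.slope H) * rlIntegral (1 - P.β₁) (fun _ => 1) t
        + (P.mu 2 * G 2 - P.mu 2 * H 2) * (2 * rlIntegral (2 - P.β₁) (fun _ => 1) t)
        + (rlIntegral (P.α - P.β₁) y t - rlIntegral (P.α - P.β₁) z t) := by
      simp only [profile, coef, Matrix.cons_val]
      ring
    have e3 : P.rhoTilde 1 * e 1 + P.rhoTilde 2 * e 2 =
        E₁ * (P.T ^ (1 - P.β₁) / Real.Gamma (2 - P.β₁))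
        + E₂ * (2 * (P.T ^ (2 - P.β₁) / Real.Gamma (3 - P.β₁))) := by
      simp only [rhoTilde, hE₁, hE₂, Matrix.cons_val]
      ring
    rw [e2, e3]
    exact (abs_add_le _ _).trans (add_le_add ((abs_add_le _ _).trans (add_le_add
      (hterm hd1 hJ1.1 hJ1.2) (hterm hd2 (by linarith [hJ2.1]) (by linarith [hJ2.2])))) hδ1)
  · have hJ2 := hJ (2 - P.β₂) (by linarith)
    rw [show 2 - P.β₂ + 1 = 3 - P.β₂ by ring] at hJ2
    have e2 : P.profile (P.coef G) y 2 t - P.profile (P.coef H) z 2 t =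
        (P.mu 2 * G 2 - P.mu 2 * H 2) * (2 * rlIntegral (2 - P.β₂) (fun _ => 1) t)
        + (rlIntegral (P.α - P.β₂) y t - rlIntegral (P.α - P.β₂) z t) := by
      simp only [profile, coef, Matrix.cons_val]
      ring
    have e3 : P.rhoHat 2 * e 2 = E₂ * (2 * (P.T ^ (2 - P.β₂) / Real.Gamma (3 - P.β₂))) := by
      simp only [rhoHat, hE₂, Matrix.cons_val]
      ring
    rw [e2, e3]
    exact (abs_add_le _ _).trans (add_le_add
      (hterm hd2 (by linarith [hJ2.1]) (by linarith [hJ2.2])) hδ2)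

/-- Lipschitz estimate for the boundary data. -/
theorem abs_bdryData_sub_le {P : FracBVP} {τ N D : ℝ} {n : Fin 3 → ℝ} {u v y z : ℝ → ℝ}
    (hg : ∀ i, |(∫ s in (0 : ℝ)..P.T, P.g i s (u s)) - ∫ s in (0 : ℝ)..P.T, P.g i s (v s)| ≤
      n i * D)
    (hIT : ∀ i, |rlIntegral (P.α - P.β i) y P.T - rlIntegral (P.α - P.β i) z P.T| ≤
      P.T ^ (P.α - P.β i - τ) / Real.Gamma (P.α - P.β i) * P.holderFactor τ i * N * D)
    (hIη : ∀ i, |rlIntegral (P.α - P.β i) y P.η - rlIntegral (P.α - P.β i) z P.η| ≤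
      P.η ^ (P.α - P.β i - τ) / Real.Gamma (P.α - P.β i) * P.holderFactor τ i * N * D)
    (i : Fin 3) :
    |P.bdryData u y i - P.bdryData v z i| ≤
      (P.boundaryTerm τ i * N + |P.lam i| * n i) * D := by
  have h1 : |P.lam i * ((∫ s in (0 : ℝ)..P.T, P.g i s (u s)) -
      ∫ s in (0 : ℝ)..P.T, P.g i s (v s))| ≤ |P.lam i| * (n i * D) := by
    rw [abs_mul]
    exact mul_le_mul_of_nonneg_left (hg i) (abs_nonneg _)
  have h2 : |P.b i * (rlIntegral (P.α - P.β i) y P.T - rlIntegral (P.α - P.β i) z P.T)| ≤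
      |P.b i| * (P.T ^ (P.α - P.β i - τ) / Real.Gamma (P.α - P.β i) *
        P.holderFactor τ i * N * D) := by
    rw [abs_mul]
    exact mul_le_mul_of_nonneg_left (hIT i) (abs_nonneg _)
  have h3 : |P.a i * (rlIntegral (P.α - P.β i) y P.η - rlIntegral (P.α - P.β i) z P.η)| ≤
      |P.a i| * (P.η ^ (P.α - P.β i - τ) / Real.Gamma (P.α - P.β i) *
        P.holderFactor τ i * N * D) := by
    rw [abs_mul]
    exact mul_le_mul_of_nonneg_left (hIη i) (abs_nonneg _)
  -- `bdryData` has no `a 0` term, since `I^α y` vanishes at 0, but `boundaryTerm τ 0` has one; its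
  -- nonnegativity settles `i = 0`.
  have h4 := (abs_nonneg _).trans h3
  have e : (P.boundaryTerm τ i * N + |P.lam i| * n i) * D = |P.lam i| * (n i * D) +
      (|P.b i| * (P.T ^ (P.α - P.β i - τ) / Real.Gamma (P.α - P.β i) *
        P.holderFactor τ i * N * D) +
      |P.a i| * (P.η ^ (P.α - P.β i - τ) / Real.Gamma (P.α - P.β i) *
        P.holderFactor τ i * N * D)) := by
    rw [boundaryTerm]
    ring
  rw [e]
  rw [abs_le] at h1 h2 h3 ⊢
  fin_cases i <;>
    simp only [bdryData, β, Matrix.cons_val, Fin.zero_eta, Fin.mk_one, Fin.reduceFinMk,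
      sub_zero] at h1 h2 h3 h4 ⊢ <;>
    constructor <;> linarith

/-- The Lipschitz constants of the three components of `op`, for `N = ‖l_f‖_{1/τ}` and
`n i = ‖l_{g_i}‖₁`. -/
def lipConst (P : FracBVP) (τ N : ℝ) (n : Fin 3 → ℝ) : Fin 3 → ℝ :=
  ![P.Delta0 τ * N + ∑ i : Fin 3, P.rho i * |P.lam i| * n i,
    P.Delta1 τ * N + (P.rhoTilde 1 * |P.lam 1| * n 1 + P.rhoTilde 2 * |P.lam 2| * n 2),
    P.Delta2 τ * N + P.rhoHat 2 * |P.lam 2| * n 2]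

/-- The free bound `D` serves two purposes: as the distance of two points it gives the contraction,
and `D = 0` shows that `op` depends only on values on `[0, T]`. -/
theorem abs_op_sub_le {P : FracBVP} {τ : ℝ} {lf : ℝ → ℝ} {lg : Fin 3 → ℝ → ℝ}
    (hβ₁ : 0 < P.β₁ ∧ P.β₁ ≤ 1) (hβ₂ : 1 < P.β₂ ∧ P.β₂ ≤ 2)
    (hη : 0 < P.η ∧ P.η < P.T)
    (hf : ContinuousOn (fun p : ℝ × ℝ × ℝ × ℝ => P.f p.1 p.2.1 p.2.2.1 p.2.2.2)
      (Icc 0 P.T ×ˢ univ))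
    (hτ : 0 < τ ∧ τ < 1 ∧ τ < P.α - P.β₂)
    (hlf_nonneg : ∀ t ∈ Icc 0 P.T, 0 ≤ lf t)
    (hlf : MemLp lf (ENNReal.ofReal (1 / τ)) (volume.restrict (Icc 0 P.T)))
    (hf_lip : ∀ t ∈ Icc 0 P.T, ∀ u₁ u₂ u₃ v₁ v₂ v₃ : ℝ,
      |P.f t u₁ u₂ u₃ - P.f t v₁ v₂ v₃| ≤ lf t * (|u₁ - v₁| + |u₂ - v₂| + |u₃ - v₃|))
    (hg : ∀ i, ContinuousOn (fun p : ℝ × ℝ => P.g i p.1 p.2) (Icc 0 P.T ×ˢ univ))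
    (hlg_nonneg : ∀ i, ∀ t ∈ Icc 0 P.T, 0 ≤ lg i t)
    (hlg : ∀ i, MemLp (lg i) 1 (volume.restrict (Icc 0 P.T)))
    (hg_lip : ∀ i, ∀ t ∈ Icc 0 P.T, ∀ u v : ℝ, |P.g i t u - P.g i t v| ≤ lg i t * |u - v|)
    {U V : Fin 3 → ℝ → ℝ} (hU : ∀ i, ContinuousOn (U i) (Icc 0 P.T))
    (hV : ∀ i, ContinuousOn (V i) (Icc 0 P.T)) {D : ℝ}
    (hUV : ∀ s ∈ Icc 0 P.T, |U 0 s - V 0 s| + |U 1 s - V 1 s| + |U 2 s - V 2 s| ≤ D)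
    {t : ℝ} (ht : t ∈ Icc 0 P.T) (i : Fin 3) :
    |P.op U i t - P.op V i t| ≤
      P.lipConst τ (P.normLp (1 / τ) lf) (fun i => P.normLp 1 (lg i)) i * D := by
  have hT : 0 < P.T := hη.1.trans hη.2
  have hTm : P.T ∈ Icc 0 P.T := ⟨hT.le, le_rfl⟩
  have hηm : P.η ∈ Icc 0 P.T := ⟨hη.1.le, hη.2.le⟩
  have hD : 0 ≤ D := le_trans (by positivity) (hUV P.T hTm)
  have hντ : ∀ i, τ < P.α - P.β i := by
    intro i
    fin_cases i <;> simp only [β, Matrix.cons_val, Fin.zero_eta, Fin.mk_one, Fin.reduceFinMk] <;>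
      linarith
  have hΓ : ∀ i, 0 < Real.Gamma (P.α - P.β i) := fun i =>
    Real.Gamma_pos_of_pos (hτ.1.trans (hντ i))
  have hF : ∀ i, 0 ≤ P.holderFactor τ i := fun i =>
    Real.rpow_nonneg (div_nonneg (by linarith) (by linarith [hντ i])) _
  set N := P.normLp (1 / τ) lf with hN
  have hN0 : 0 ≤ N := ENNReal.toReal_nonneg
  have hUc := continuousOn_rhs hf hU
  have hVc := continuousOn_rhs hf hV
  have hI : ∀ i, ∀ t ∈ Icc 0 P.T,
      |rlIntegral (P.α - P.β i) (P.rhs U) t - rlIntegral (P.α - P.β i) (P.rhs V) t| ≤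
      t ^ (P.α - P.β i - τ) / Real.Gamma (P.α - P.β i) * P.holderFactor τ i * N * D := by
    intro i t ht
    rw [← rlIntegral_sub (hτ.1.trans (hντ i)).le hUc hVc ht]
    exact abs_rlIntegral_le_holder hτ.1 hτ.2.1 (hντ i) hlf hlf_nonneg hD
      (fun s hs => (hf_lip s hs _ _ _ _ _ _).trans
        (mul_le_mul_of_nonneg_left (hUV s hs) (hlf_nonneg s hs))) ht
  have hgi : ∀ i, |(∫ s in (0 : ℝ)..P.T, P.g i s (U 0 s)) -
      ∫ s in (0 : ℝ)..P.T, P.g i s (V 0 s)| ≤ P.normLp 1 (lg i) * D := fun i =>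
    abs_integral_sub_le_normLp_one hT.le (hg i) (hlg_nonneg i) (hlg i) (hg_lip i) (hU 0) (hV 0)
      fun s hs => by linarith [hUV s hs, abs_nonneg (U 1 s - V 1 s), abs_nonneg (U 2 s - V 2 s)]
  have hG := abs_bdryData_sub_le hgi (fun i => hI i _ hTm)
    (fun i => hI i _ hηm)
  have hδ : ∀ i, |rlIntegral (P.α - P.β i) (P.rhs U) t - rlIntegral (P.α - P.β i) (P.rhs V) t| ≤
      P.interiorTerm τ i * N * D := fun i => (hI i t ht).trans <| by
    rw [interiorTerm]
    have h1 := Real.rpow_le_rpow ht.1 ht.2 (show 0 ≤ P.α - P.β i - τ by linarith [hντ i])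
    have h2 := hΓ i
    have h3 := hF i
    gcongr
  obtain ⟨h0, h1, h2⟩ := abs_profile_sub_le hT hβ₁.2 hβ₂.2 hG ht hδ
  fin_cases i
  · refine h0.trans_eq ?_
    simp only [lipConst, Delta0, Fin.sum_univ_three, Fin.zero_eta, Matrix.cons_val]
    ring
  · refine h1.trans_eq ?_
    simp only [lipConst, Delta1, Fin.mk_one, Matrix.cons_val]
    ring
  · refine h2.trans_eq ?_
    simp only [lipConst, Delta2, Fin.reduceFinMk, Matrix.cons_val]
    ring

end FracBVP

end

/-! ### Contraction argument -/

theorem mainTheorem2 (P : FracBVP) (τ : ℝ) (lf : ℝ → ℝ) (lg : Fin 3 → ℝ → ℝ)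
    (hα : 2 < P.α ∧ P.α ≤ 3)
    (hβ₁ : 0 < P.β₁ ∧ P.β₁ ≤ 1)
    (hβ₂ : 1 < P.β₂ ∧ P.β₂ ≤ 2)
    (hη : 0 < P.η ∧ P.η < P.T)
    (hab0 : P.a 0 + P.b 0 ≠ 0)
    (hab1 : P.a 1 * P.η ^ (1 - P.β₁) + P.b 1 * P.T ^ (1 - P.β₁) ≠ 0)
    (hab2 : P.a 1 * P.η ^ (2 - P.β₁) + P.b 1 * P.T ^ (2 - P.β₁) ≠ 0)
    (hab3 : P.a 2 * P.η ^ (2 - P.β₂) + P.b 2 * P.T ^ (2 - P.β₂) ≠ 0)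
    (hf : ContinuousOn (fun p : ℝ × ℝ × ℝ × ℝ => P.f p.1 p.2.1 p.2.2.1 p.2.2.2)
      (Icc 0 P.T ×ˢ univ))
    (hτ : 0 < τ ∧ τ < 1 ∧ τ < P.α - P.β₂)
    (hlf_nonneg : ∀ t ∈ Icc 0 P.T, 0 ≤ lf t)
    (hlf : MemLp lf (ENNReal.ofReal (1 / τ)) (volume.restrict (Icc 0 P.T)))
    (hf_lip : ∀ t ∈ Icc 0 P.T, ∀ u₁ u₂ u₃ v₁ v₂ v₃ : ℝ,
      |P.f t u₁ u₂ u₃ - P.f t v₁ v₂ v₃| ≤ lf t * (|u₁ - v₁| + |u₂ - v₂| + |u₃ - v₃|))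
    (hg : ∀ i, ContinuousOn (fun p : ℝ × ℝ => P.g i p.1 p.2) (Icc 0 P.T ×ˢ univ))
    (hlg_nonneg : ∀ i, ∀ t ∈ Icc 0 P.T, 0 ≤ lg i t)
    (hlg : ∀ i, MemLp (lg i) 1 (volume.restrict (Icc 0 P.T)))
    (hg_lip : ∀ i, ∀ t ∈ Icc 0 P.T, ∀ u v : ℝ, |P.g i t u - P.g i t v| ≤ lg i t * |u - v|)
    (hcc : (P.Delta0 τ + P.Delta1 τ + P.Delta2 τ) * P.normLp (1 / τ) lf
        + ∑ i : Fin 3, P.rho i * |P.lam i| * P.normLp 1 (lg i)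
        + (P.rhoTilde 1 * |P.lam 1| * P.normLp 1 (lg 1)
          + P.rhoTilde 2 * |P.lam 2| * P.normLp 1 (lg 2))
        + P.rhoHat 2 * |P.lam 2| * P.normLp 1 (lg 2) < 1) :
    ∃ u : ℝ → ℝ, P.IsSolution u ∧ ∀ v : ℝ → ℝ, P.IsSolution v → EqOn v u (Icc 0 P.T) := by
  have hT : 0 < P.T := hη.1.trans hη.2
  -- The ℓ¹ product matches the sum of differences in the Lipschitz condition on `f`, and makes the
  -- three component constants add.
  let X := PiLp 1 fun _ : Fin 3 => C(Icc 0 P.T, ℝ)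
  let ext : X → Fin 3 → ℝ → ℝ := fun x i => IccExtend hT.le (x i)
  have hext : ∀ x i, Continuous (ext x i) := fun x i => (x i).continuous.Icc_extend'
  have hext_apply : ∀ (x : X) i (t : Icc 0 P.T), ext x i t = x i t := fun x i t =>
    IccExtend_val _ _ _
  have hop : ∀ {U : Fin 3 → ℝ → ℝ}, (∀ i, ContinuousOn (U i) (Icc 0 P.T)) →
      ∀ i, ContinuousOn (P.op U i) (Icc 0 P.T) := fun {U} hU i =>
    FracBVP.continuousOn_profile hα.1 hβ₁.2 hβ₂.2 _ (FracBVP.continuousOn_rhs hf hU) i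
  let Φ : X → X := fun x => WithLp.toLp 1 fun i =>
    ⟨(Icc 0 P.T).domRestrict (P.op (ext x) i),
      continuousOn_iff_continuous_domRestrict.1 (hop (fun i => (hext x i).continuousOn) i)⟩
  set L := P.lipConst τ (P.normLp (1 / τ) lf) (fun i => P.normLp 1 (lg i)) with hL
  have hL1 : L 0 + L 1 + L 2 < 1 := by
    simp only [hL, FracBVP.lipConst, Matrix.cons_val]
    linarith
  have hΦ : ∀ x y : X, dist (Φ x) (Φ y) ≤ (L 0 + L 1 + L 2) * dist x y := by
    intro x y
    have hD : ∀ s ∈ Icc 0 P.T, |ext x 0 s - ext y 0 s| + |ext x 1 s - ext y 1 s| +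
        |ext x 2 s - ext y 2 s| ≤ dist x y := by
      intro s hs
      rw [PiLp.dist_eq_of_L1, Fin.sum_univ_three]
      have h : ∀ i, |ext x i s - ext y i s| ≤ dist (x i) (y i) := fun i => by
        rw [hext_apply x i ⟨s, hs⟩, hext_apply y i ⟨s, hs⟩, ← Real.dist_eq]
        exact ContinuousMap.dist_apply_le_dist _
      exact add_le_add (add_le_add (h 0) (h 1)) (h 2)
    have hnonempty : Nonempty (Icc 0 P.T) := ⟨⟨0, le_rfl, hT.le⟩⟩
    have h : ∀ i, dist (Φ x i) (Φ y i) ≤ L i * dist x y := fun i => by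
      rw [ContinuousMap.dist_le_iff_of_nonempty]
      exact fun t => FracBVP.abs_op_sub_le hβ₁ hβ₂ hη hf hτ hlf_nonneg hlf hf_lip hg hlg_nonneg
        hlg hg_lip (fun i => (hext x i).continuousOn) (fun i => (hext y i).continuousOn) hD t.2 i
    rw [PiLp.dist_eq_of_L1, Fin.sum_univ_three]
    linarith [h 0, h 1, h 2]
  -- Truncation at 0 by `toNNReal` can only enlarge the constant and keeps it below 1, so its sign
  -- need not be known.
  have hcontr : ContractingWith (L 0 + L 1 + L 2).toNNReal Φ := by
    refine ⟨by simpa using hL1, LipschitzWith.of_dist_le_mul fun x y => (hΦ x y).trans ?_⟩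
    exact mul_le_mul_of_nonneg_right (Real.le_coe_toNNReal _) dist_nonneg
  have : Nonempty X := ⟨0⟩
  have : CompleteSpace X := inferInstanceAs (CompleteSpace (PiLp 1 _))
  set x := ContractingWith.fixedPoint Φ hcontr
  have hx : Φ x = x := hcontr.fixedPoint_isFixedPt
  refine ⟨ext x 0, FracBVP.isSolution_of_eqOn_op hα hβ₁ hβ₂ hη hab0 hab1 hab2 hab3 hf
    (fun i => (hext x i).continuousOn) fun i t ht => ?_, fun v hv => ?_⟩
  · rw [hext_apply x i ⟨t, ht⟩]
    nth_rewrite 1 [← hx]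
    rfl
  · set V : Fin 3 → ℝ → ℝ := ![v, caputoDeriv P.T P.β₁ v, caputoDeriv P.T P.β₂ v] with hV
    have hVop := hv.eqOn_op hα hβ₁ hβ₂ hη hab0 hab1 hab2 hab3
    have hVc : ∀ i, ContinuousOn (V i) (Icc 0 P.T) := by
      intro i
      fin_cases i
      · exact hv.mem.1
      · exact continuousOn_caputoDeriv hT hv.mem.2.1
      · exact continuousOn_caputoDeriv hT hv.mem.2.2
    let y : X := WithLp.toLp 1 fun i =>
      ⟨(Icc 0 P.T).domRestrict (V i), continuousOn_iff_continuous_domRestrict.1 (hVc i)⟩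
    have hyV : ∀ i, EqOn (ext y i) (V i) (Icc 0 P.T) := fun i t ht => hext_apply y i ⟨t, ht⟩
    -- The extension of `y` and the triple `V` agree on `[0, T]`, so with `D = 0` the operator gives
    -- them equal values there, and `y` is a fixed point of `Φ`.
    have hsmall : ∀ s ∈ Icc 0 P.T, |ext y 0 s - V 0 s| + |ext y 1 s - V 1 s| +
        |ext y 2 s - V 2 s| ≤ 0 := fun s hs => by
      simp [hyV _ hs]
    have hy : Φ y = y := by
      ext i t
      have h := FracBVP.abs_op_sub_le hβ₁ hβ₂ hη hf hτ hlf_nonneg hlf hf_lip hg hlg_nonneg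
        hlg hg_lip (fun i => (hext y i).continuousOn) hVc hsmall t.2 i
      rw [mul_zero, abs_nonpos_iff, sub_eq_zero] at h
      exact h.trans (hVop i t.2).symm
    have hxy : y = x := hcontr.fixedPoint_unique hy
    intro t ht
    rw [← hxy]
    exact (hyV 0 ht).symm
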